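/- **Setting.** Let $\mathcal G=(\mathcal I,\mathcal E)$ be a finite connected simple graph of buses and lines with an arbitrary orientation and incidence matrix $D$ ($d_{ki}=1$ if $i$ is the positive end of $e_k$, $-1$ if it is the negative end, $0$ otherwise), inertias $M_i>0$, dampings $E_i>0$, line susceptances $b_k>0$, $Y_b=\mathrm{diag}(b_k)$, and the dynamics $$\dot f=Y_bD\omega,\qquad M\dot\omega=-E\omega-D^Tf+p+\alpha .$$ The injection $p$ is piecewise continuous on $[0,\infty)$, and $p(t)=p^*$ for all $t\ge\bar t$, for some $\bar t\geq 0$, with $\sum_ip^*_i=0$. Let $\mathcal I^\omega\subseteq\mathcal I^u\subseteq\mathcal I$ be the targeted and the controlled buses, with constants $\epsilon_i,T_i,c_i>0$ for $i\in\mathcal I^u$ and $\underline\omega_i<\underline\omega_i^{thr}<0<\bar\omega_i^{thr}<\bar\omega_i$, $\bar\gamma_i,\underline\gamma_i>0$ for $i\in\mathcal I^\omega$, and let $d,T,\tilde t>0$, $N=\lceil\tilde t/T\rceil$. **MPC problem.** For a network with these data, a forecast $\hat p(0),\dots,\hat p(N-1)$ and a sampled state $(f_0,\omega_0,\alpha_0)$,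 minimize $\sum_{i\in\mathcal I^u}c_i\hat u_i^2+d\beta^2$ over $\hat f(k),\hat\omega(k),\hat\alpha(k)$ $(0\le k\le N)$, $\hat u$, $\beta$ subject to, for $0\le k<N$, $\hat f(k+1)=\hat f(k)+TY_bD\hat\omega(k)$; $M\hat\omega(k+1)=M\hat\omega(k)+T\{-E\hat\omega(k)-D^T\hat f(k)+\hat p(k)+\hat u\}$; $\hat\alpha_i(k+1)=\hat\alpha_i(k)+T\{-\hat\alpha_i(k)/T_i-\hat\omega_i(k)+\hat u_i\}$ for $i\in\mathcal I^u$; $\hat\alpha_i\equiv0$, $\hat u_i=0$ for $i\notin\mathcal I^u$; $(\hat f,\hat\omega,\hat\alpha)(0)=(f_0,\omega_0,\alpha_0)$; $\underline\omega_i-\beta\le\hat\omega_i(k+1)\le\bar\omega_i+\beta$ for $i\in\mathcal I^\omega$; and $|\hat u_i|\le\epsilon_i|\alpha_{0,i}|$ for $i\in\mathcal I^u$. **Distributed controller.** Let $\mathcal I_1,\dots,\mathcal I_r\subseteq\mathcal I$ be the bus sets of induced subgraphs such that each $i\in\mathcal I^u$ lies in exactly one $\mathcal I_\beta$. Each region has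 sampling times $0=\Delta^0_\beta<\Delta^1_\beta<\cdots\to\infty$. At $t=\Delta^j_\beta$ region $\beta$ solves the MPC problem of its induced subnetwork from its current regional state $(f,\omega,\alpha_{MPC})$, with the forecast at bus $i\in\mathcal I_\beta$ and step $k$ equal to $p^{fcst}_{t,i}(t+kT)$ (an arbitrary given forecast) plus the net inflow at time $t$ into $i$ through the lines joining $\mathcal I_\beta$ to its complement, kept constant over the horizon. For $i\in\mathcal I^u\cap\mathcal I_\beta$, $u_{MPC,i}$ equals the optimal $\hat u_i$ on $[\Delta^j_\beta,\Delta^{j+1}_\beta)$. Further, $$\dot\alpha_{MPC,i}=-\alpha_{MPC,i}/T_i-\omega_i+\mathrm{sat}\big(u_{MPC,i};\epsilon_i|\alpha_{MPC,i}|,-\epsilon_i|\alpha_{MPC,i}|\big)\ (i\in\mathcal I^u),\qquad \alpha_{MPC,i}\equiv0\ (i\notin\mathcal I^u),$$ $\mathrm{sat}(a;a^{\max},a^{\min})$ being the truncation of $a$ to $[a^{\min},a^{\max}]$. With $v_i=E_i\omega_i+[D^Tf]_i-p_i-\alpha_{MPC,i}$, for $i\in\mathcal I^\omega$ put $\alpha_{DF,i}=\min\{0,\bar\gamma_i(\bar\omega_i-\omega_i)/(\omega_i-\bar\omega_i^{thr})+v_i\}$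 if $\omega_i>\bar\omega_i^{thr}$, $\alpha_{DF,i}=\max\{0,\underline\gamma_i(\underline\omega_i-\omega_i)/(\underline\omega_i^{thr}-\omega_i)+v_i\}$ if $\omega_i<\underline\omega_i^{thr}$, and $\alpha_{DF,i}=0$ otherwise; $\alpha_{DF,i}=0$ for $i\notin\mathcal I^\omega$. Finally $\alpha=\alpha_{DF}+\alpha_{MPC}$. Trajectories $(f,\omega,\alpha_{MPC})$ are continuous and satisfy the differential equations except at sampling times and at discontinuities of $p$; the initial state is arbitrary, apart from $\alpha_{MPC,i}(0)=0$ for $i\notin\mathcal I^u$. **Proposition.** Assume $\epsilon_iT_i<1$ for every $i\in\mathcal I^u$. For every $f_0\in\mathbb R^{\mathcal E}$ there is a unique $f_\infty$ with $D^Tf_\infty=p^*$ and $f_\infty-f_0\in\mathrm{range}(Y_bD)$ (so $f_\infty$ does not depend on $f_0$ when $f_0\in\mathrm{range}(Y_bD)$), and every open-loop trajectory ($\alpha\equiv0$) on $[0,\infty)$ with $f(0)=f_0$ converges to $(f_\infty,\mathbf 0)$. For every closed-loop trajectory on $[0,\infty)$: 1. (frequency invariance) if $i\in\mathcal I^\omega$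 and $\omega_i(0)\in[\underline\omega_i,\bar\omega_i]$, then $\omega_i(t)\in[\underline\omega_i,\bar\omega_i]$ for all $t\ge0$; 2. (frequency attractivity) if $i\in\mathcal I^\omega$ and $\omega_i(0)\notin[\underline\omega_i,\bar\omega_i]$, then there is a finite $t_0\geq 0$ with $\omega_i(t)\in[\underline\omega_i,\bar\omega_i]$ for all $t\ge t_0$; 3. (asymptotic stability) $(f(t),\omega(t))$ converges to the open-loop equilibrium $(f_\infty,\mathbf 0)$ belonging to $f_0=f(0)$; moreover, this equilibrium is Lyapunov stable: for every $\eta>0$ there is $\delta>0$, the same for all closed-loop trajectories and all $t_1\ge\bar t$, such that if $f-f_\infty$, $\omega$ and $\alpha_{MPC}$ have norm less than $\delta$ at time $t_1$, then they have norm less than $\eta$ at all $t\ge t_1$; 4. $\alpha(t)$, $\alpha_{MPC}(t)$ and $\alpha_{DF}(t)$ converge to $\mathbf 0$ as $t\to\infty$. Moreover there is no finite escape time: every closed-loop trajectory on an interval $[0,\tau)$ with $0<\tau<\infty$ is bounded, and it satisfies frequency invariance on $[0,\tau)$. -/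

import Mathlib

open Set Filter Topology

noncomputable section

/-- `p` is piecewise continuous on `[0, ∞)`: finitely many discontinuities in each bounded interval,
with one-sided limits everywhere. -/
def PiecewiseContinuous {X : Type*} [TopologicalSpace X] (p : ℝ → X) : Prop :=
  (∃ S : Set ℝ, (∀ R : ℝ, (S ∩ Icc 0 R).Finite) ∧
    ∀ t : ℝ, 0 ≤ t → t ∉ S → ContinuousWithinAt p (Ici 0) t) ∧
  (∀ t : ℝ, 0 ≤ t → ∃ x : X, Tendsto p (𝓝[>] t) (𝓝 x)) ∧
  (∀ t : ℝ, 0 < t → ∃ x : X, Tendsto p (𝓝[<] t) (𝓝 x))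

/-- The saturation function `sat(a; hi, lo)`. -/
def sat (a hi lo : ℝ) : ℝ := if hi ≤ a then hi else if a ≤ lo then lo else a

/-- An oriented simple graph with buses `V` and lines `L`, together with the inertia and damping of
each bus and the susceptance of each line. -/
structure PowerNetwork (V L : Type*) where
  /-- positive end of a line -/
  pos : L → V
  /-- negative end of a line -/
  neg : L → V
  pos_ne_neg : ∀ e, pos e ≠ neg e
  simple : Function.Injective fun e => s(pos e, neg e)
  inertia : V → ℝ
  damping : V → ℝ
  susceptance : L → ℝ
  inertia_pos : ∀ i, 0 < inertia i
  damping_pos : ∀ i, 0 < damping i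
  susceptance_pos : ∀ e, 0 < susceptance e

/-- The controlled buses `Iu`, the targeted buses `Iw`, and the design parameters of the MPC
component, the stability filter, the low-pass filter and the direct feedback layer. Only the values
at buses of `Iu` (of `Iw` for the frequency bounds, thresholds and gains) matter. -/
structure ControlDesign (V : Type*) where
  Iu : Finset V
  Iw : Finset V
  Iw_subset : Iw ⊆ Iu
  /-- discretization step -/
  step : ℝ
  step_pos : 0 < step
  /-- prediction horizon (in time units) -/
  horizon : ℝ
  horizon_pos : 0 < horizon
  /-- control weights -/
  c : V → ℝ
  c_pos : ∀ i ∈ Iu, 0 < c i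
  /-- penalty for frequency violation -/
  d : ℝ
  d_pos : 0 < d
  ε : V → ℝ
  ε_pos : ∀ i ∈ Iu, 0 < ε i
  /-- time constants of the low-pass filter -/
  Tf : V → ℝ
  Tf_pos : ∀ i ∈ Iu, 0 < Tf i
  /-- lower safe frequency bound -/
  wlo : V → ℝ
  /-- upper safe frequency bound -/
  whi : V → ℝ
  /-- lower threshold of the direct feedback -/
  thrlo : V → ℝ
  /-- upper threshold of the direct feedback -/
  thrhi : V → ℝ
  wlo_lt : ∀ i ∈ Iw, wlo i < thrlo i
  thrlo_neg : ∀ i ∈ Iw, thrlo i < 0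
  thrhi_pos : ∀ i ∈ Iw, 0 < thrhi i
  lt_whi : ∀ i ∈ Iw, thrhi i < whi i
  γlo : V → ℝ
  γhi : V → ℝ
  γlo_pos : ∀ i ∈ Iw, 0 < γlo i
  γhi_pos : ∀ i ∈ Iw, 0 < γhi i

namespace ControlDesign

variable {V : Type*}

/-- The number `N = ⌈horizon / step⌉` of prediction steps. -/
def steps (C : ControlDesign V) : ℕ := ⌈C.horizon / C.step⌉₊

/-- The same design, on the buses of a region. -/
def restrict [DecidableEq V] (C : ControlDesign V) (s : Finset V) :
    ControlDesign {i : V // i ∈ s} where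
  Iu := C.Iu.subtype (· ∈ s)
  Iw := C.Iw.subtype (· ∈ s)
  Iw_subset := fun i hi => by
    rw [Finset.mem_subtype] at hi ⊢
    exact C.Iw_subset hi
  step := C.step
  step_pos := C.step_pos
  horizon := C.horizon
  horizon_pos := C.horizon_pos
  c := fun i => C.c i
  c_pos := fun i hi => C.c_pos i (Finset.mem_subtype.1 hi)
  d := C.d
  d_pos := C.d_pos
  ε := fun i => C.ε i
  ε_pos := fun i hi => C.ε_pos i (Finset.mem_subtype.1 hi)
  Tf := fun i => C.Tf i
  Tf_pos := fun i hi => C.Tf_pos i (Finset.mem_subtype.1 hi)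
  wlo := fun i => C.wlo i
  whi := fun i => C.whi i
  thrlo := fun i => C.thrlo i
  thrhi := fun i => C.thrhi i
  wlo_lt := fun i hi => C.wlo_lt i (Finset.mem_subtype.1 hi)
  thrlo_neg := fun i hi => C.thrlo_neg i (Finset.mem_subtype.1 hi)
  thrhi_pos := fun i hi => C.thrhi_pos i (Finset.mem_subtype.1 hi)
  lt_whi := fun i hi => C.lt_whi i (Finset.mem_subtype.1 hi)
  γlo := fun i => C.γlo i
  γhi := fun i => C.γhi i
  γlo_pos := fun i hi => C.γlo_pos i (Finset.mem_subtype.1 hi)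
  γhi_pos := fun i hi => C.γhi_pos i (Finset.mem_subtype.1 hi)

/-- The stability filter at bus `i`, from the current low-pass filter state `a` and MPC output `u`. -/
def stabilityFilter (C : ControlDesign V) (a u : V → ℝ) (i : V) : ℝ :=
  sat (u i) (C.ε i * |a i|) (-(C.ε i * |a i|))

end ControlDesign

/-- The decision variables of the MPC optimization problem with `N` prediction steps: trajectories
of flows, frequencies and low-pass filter states, a constant input, and a violation margin. -/
structure MPCVars (V L : Type*) (N : ℕ) where
  F : Fin (N + 1) → L → ℝ
  W : Fin (N + 1) → V → ℝ
  A : Fin (N + 1) → V → ℝ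
  u : V → ℝ
  β : ℝ

namespace PowerNetwork

variable {V L : Type*}

/-- The underlying undirected graph. -/
def graph (net : PowerNetwork V L) : SimpleGraph V :=
  SimpleGraph.fromEdgeSet (Set.range fun e => s(net.pos e, net.neg e))

/-- The subnetwork induced on a set `s` of buses: it has the lines with both ends in `s`. -/
def induce (net : PowerNetwork V L) (s : Finset V) :
    PowerNetwork {i : V // i ∈ s} {e : L // net.pos e ∈ s ∧ net.neg e ∈ s} where
  pos := fun e => ⟨net.pos e, e.2.1⟩
  neg := fun e => ⟨net.neg e, e.2.2⟩
  pos_ne_neg := fun e h => net.pos_ne_neg e (congrArg Subtype.val h)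
  simple := fun e e' h => Subtype.ext (net.simple
    (by simpa using congrArg (Sym2.map (Subtype.val : {i : V // i ∈ s} → V)) h))
  inertia := fun i => net.inertia i
  damping := fun i => net.damping i
  susceptance := fun e => net.susceptance e
  inertia_pos := fun i => net.inertia_pos i
  damping_pos := fun i => net.damping_pos i
  susceptance_pos := fun e => net.susceptance_pos e

/-- The incidence matrix `D`. -/
def incidence [DecidableEq V] (net : PowerNetwork V L) : Matrix L V ℝ :=
  Matrix.of fun e i => if i = net.pos e then 1 else if i = net.neg e then -1 else 0

/-- `D ω` on each line. -/
def diff [Fintype V] [DecidableEq V] (net : PowerNetwork V L) (w : V → ℝ) : L → ℝ :=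
  net.incidence.mulVec w

/-- `Dᵀ f` at each bus. -/
def outflow [Fintype L] [DecidableEq V] (net : PowerNetwork V L) (f : L → ℝ) : V → ℝ :=
  net.incidence.transpose.mulVec f

/-- The network dynamics `f' = Y_b D ω`, `M ω' = -E ω - Dᵀ f + p + α` holds at time `t`. -/
def DynamicsAt [Fintype V] [Fintype L] [DecidableEq V] (net : PowerNetwork V L)
    (p α : ℝ → V → ℝ) (f : ℝ → L → ℝ) (w : ℝ → V → ℝ) (t : ℝ) : Prop :=
  HasDerivAt f (fun e => net.susceptance e * net.diff (w t) e) t ∧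
  ∃ w' : V → ℝ, HasDerivAt w w' t ∧ ∀ i,
    net.inertia i * w' i =
      -(net.damping i * w t i) - net.outflow (f t) i + p t i + α t i

/-- `finf` is the flow of the equilibrium `(finf, 0)` of the uncontrolled network with constant
injection `pstar` that is reachable from the flow `f0`: it balances `pstar`, and `finf - f0` lies in
the range of `Y_b D`, which contains `f(t) - f(0)` for every motion of the network. -/
def IsEquilibriumFlow [Fintype V] [Fintype L] [DecidableEq V] (net : PowerNetwork V L)
    (pstar : V → ℝ) (f0 finf : L → ℝ) : Prop :=
  net.outflow finf = pstar ∧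
  ∃ θ : V → ℝ, ∀ e, finf e = f0 e + net.susceptance e * net.diff θ e

/-- A trajectory of the uncontrolled network on `[0, ∞)`. The differential equation is required at
every positive time at which the injection is continuous. -/
structure IsOpenLoopTrajectory [Fintype V] [Fintype L] [DecidableEq V] (net : PowerNetwork V L)
    (p : ℝ → V → ℝ) (f : ℝ → L → ℝ) (w : ℝ → V → ℝ) : Prop where
  continuous_flow : ContinuousOn f (Ici 0)
  continuous_freq : ContinuousOn w (Ici 0)
  dynamics : ∀ t, 0 < t → ContinuousAt p t → net.DynamicsAt p (fun _ _ => 0) f w t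

/-- The constraints of the MPC problem, for the forecast `p k` of the injection at step `k` and the
sampled flows `f0`, frequencies `w0` and low-pass filter states `a0`. -/
structure MPCFeasible [Fintype V] [Fintype L] [DecidableEq V] (net : PowerNetwork V L)
    (C : ControlDesign V) (p : ℕ → V → ℝ) (f0 : L → ℝ) (w0 a0 : V → ℝ)
    (x : MPCVars V L C.steps) : Prop where
  flow : ∀ (k : Fin C.steps) (e : L), x.F k.succ e =
    x.F k.castSucc e + C.step * (net.susceptance e * net.diff (x.W k.castSucc) e)
  freq : ∀ (k : Fin C.steps) (i : V), net.inertia i * x.W k.succ i =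
    net.inertia i * x.W k.castSucc i + C.step *
      (-(net.damping i * x.W k.castSucc i) - net.outflow (x.F k.castSucc) i + p k i + x.u i)
  filter : ∀ (k : Fin C.steps), ∀ i ∈ C.Iu, x.A k.succ i =
    x.A k.castSucc i + C.step * (-(x.A k.castSucc i / C.Tf i) - x.W k.castSucc i + x.u i)
  filter_zero : ∀ (k : Fin (C.steps + 1)), ∀ i ∉ C.Iu, x.A k i = 0
  input_zero : ∀ i ∉ C.Iu, x.u i = 0
  init_flow : x.F 0 = f0
  init_freq : x.W 0 = w0
  init_filter : x.A 0 = a0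
  safe : ∀ (k : Fin C.steps), ∀ i ∈ C.Iw,
    C.wlo i - x.β ≤ x.W k.succ i ∧ x.W k.succ i ≤ C.whi i + x.β
  input_bound : ∀ i ∈ C.Iu, |x.u i| ≤ C.ε i * |a0 i|

/-- `x` is an optimal solution of the MPC problem, whose objective is `∑ cᵢ uᵢ² + d β²`. -/
def MPCOptimal [Fintype V] [Fintype L] [DecidableEq V] (net : PowerNetwork V L)
    (C : ControlDesign V) (p : ℕ → V → ℝ) (f0 : L → ℝ) (w0 a0 : V → ℝ)
    (x : MPCVars V L C.steps) : Prop :=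
  net.MPCFeasible C p f0 w0 a0 x ∧
  ∀ y : MPCVars V L C.steps, net.MPCFeasible C p f0 w0 a0 y →
    ∑ i ∈ C.Iu, C.c i * x.u i ^ 2 + C.d * x.β ^ 2 ≤
      ∑ i ∈ C.Iu, C.c i * y.u i ^ 2 + C.d * y.β ^ 2

/-- The injection that the flows `f` on the boundary lines of the region `s` cause at bus `i`:
boundary lines that enter `i` (their negative end) minus boundary lines that leave it. -/
def boundaryInjection [Fintype L] [DecidableEq V] (net : PowerNetwork V L) (s : Finset V)
    (f : L → ℝ) (i : V) : ℝ :=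
  (∑ e with net.neg e = i ∧ net.pos e ∉ s, f e) - ∑ e with net.pos e = i ∧ net.neg e ∉ s, f e

/-- `x` is an optimal solution of the MPC problem of the region `s`, sampled at time `t` in the
state `(f, w, a)`, where `pf t τ` is the injection at time `τ` as forecast at time `t`. The flows on
boundary lines act as additional injections that are constant over the horizon. -/
def RegionalMPCOptimal [Fintype V] [Fintype L] [DecidableEq V] (net : PowerNetwork V L)
    (C : ControlDesign V) (pf : ℝ → ℝ → V → ℝ) (s : Finset V) (t : ℝ) (f : L → ℝ) (w a : V → ℝ)
    (x : MPCVars {i : V // i ∈ s} {e : L // net.pos e ∈ s ∧ net.neg e ∈ s} (C.restrict s).steps) :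
    Prop :=
  (net.induce s).MPCOptimal (C.restrict s)
    (fun k i => pf t (t + k * C.step) i + net.boundaryInjection s f i)
    (fun e => f e) (fun i => w i) (fun i => a i) x

/-- `vᵢ = Eᵢ ωᵢ + [Dᵀ f]ᵢ - pᵢ - α_MPC,ᵢ`. -/
def feedbackTerm [Fintype L] [DecidableEq V] (net : PowerNetwork V L)
    (f : L → ℝ) (w p a : V → ℝ) (i : V) : ℝ :=
  net.damping i * w i + net.outflow f i - p i - a i

/-- The direct feedback control `α_DF` at bus `i`, in the state `(f, w)` with injection `p` and
bottom layer control `a`. -/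
def directFeedback [Fintype L] [DecidableEq V] (net : PowerNetwork V L) (C : ControlDesign V)
    (f : L → ℝ) (w p a : V → ℝ) (i : V) : ℝ :=
  if i ∈ C.Iw then
    if C.thrhi i < w i then
      min 0 (C.γhi i * (C.whi i - w i) / (w i - C.thrhi i) + net.feedbackTerm f w p a i)
    else if w i < C.thrlo i then
      max 0 (C.γlo i * (C.wlo i - w i) / (C.thrlo i - w i) + net.feedbackTerm f w p a i)
    else 0
  else 0

/-- `(f, w, a, u)` is a trajectory, on the time interval `J ⊆ [0, ∞)`, of the network in closed loop
with the distributed double-layered controller: flows `f`, frequencies `w`, bottom layer control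
`a = α_MPC` and regional MPC outputs `u = u_MPC`, with regions `s β` sampled at the times `Δ β j`.
The differential equations are required at every interior time that is not a sampling instant and
at which the injection is continuous. -/
structure IsClosedLoopTrajectory [Fintype V] [Fintype L] [DecidableEq V] (net : PowerNetwork V L)
    (C : ControlDesign V) (p : ℝ → V → ℝ) (pf : ℝ → ℝ → V → ℝ) {r : ℕ} (s : Fin r → Finset V)
    (Δ : Fin r → ℕ → ℝ) (J : Set ℝ) (f : ℝ → L → ℝ) (w a u : ℝ → V → ℝ) : Prop where
  continuous_flow : ContinuousOn f J
  continuous_freq : ContinuousOn w J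
  continuous_filter : ContinuousOn a J
  dynamics : ∀ t ∈ interior J, ContinuousAt p t → (∀ β j, t ≠ Δ β j) →
    net.DynamicsAt p (fun t i => net.directFeedback C (f t) (w t) (p t) (a t) i + a t i) f w t
  filter : ∀ t ∈ interior J, ContinuousAt p t → (∀ β j, t ≠ Δ β j) → ∀ i ∈ C.Iu,
    HasDerivAt (fun t => a t i)
      (-(a t i / C.Tf i) - w t i + C.stabilityFilter (a t) (u t) i) t
  filter_zero : ∀ t ∈ J, ∀ i ∉ C.Iu, a t i = 0
  mpc : ∀ β j, Δ β j ∈ J → ∃ x,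
    net.RegionalMPCOptimal C pf (s β) (Δ β j) (f (Δ β j)) (w (Δ β j)) (a (Δ β j)) x ∧
    ∀ t ∈ J, t ∈ Ico (Δ β j) (Δ β (j + 1)) → ∀ i (hi : i ∈ s β), i ∈ C.Iu → u t i = x.u ⟨i, hi⟩

end PowerNetwork

end

/-!
The proof is an energy argument that uses nothing about the MPC component except that the saturated
input of each low-pass filter is at most `ε i * |a i|`.

Let `W` be half of `∑ Mᵢ ωᵢ² + ∑ (fₑ - f∞,ₑ)² / bₑ + ∑ aᵢ²` (`PowerNetwork.energy`). The network
conserves the first two sums up to damping, injection and control; `f∞` may be replaced by any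
reference flow `g`, with `p* = Dᵀ g`. The direct feedback opposes the
sign of the frequency, so it only dissipates; the power `ωᵢ aᵢ` that the bottom layer feeds into
bus `i` is drawn from the filter state, whose equation contains `-ωᵢ`; and the leakage `1 / Tᵢ` of
the filter dominates its input gain `εᵢ`. Hence
`W' ≤ ∑ ωᵢ (pᵢ - p*ᵢ) - ∑ Eᵢ ωᵢ² - ∑ (1 / Tᵢ - εᵢ) aᵢ²` off the switching times
(`IsClosedLoopTrajectory.exists_hasDerivAt_energy`). Apart from frequency
invariance, all claims about trajectories rest on this inequality:

* taking the reference flow zero and completing squares, the energy grows at most linearly under a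
  bounded injection, so there is no finite escape time;
* once `p = p*`, the energy does not increase; being equivalent to the squared norm of the state, it
  yields Lyapunov stability with a `δ` that depends on the network and `η` only;
* the dissipated energy is finite and the state is bounded. The direct feedback is bounded on
  bounded sets, since its quotient is large only with the sign that deactivates it; so frequencies
  and filter states have bounded derivatives and tend to zero by a Barbalat argument
  (`tendsto_zero_of_dissipation`). No invariance principle is needed, so the dependence on time
  through the sampling is harmless.

When the frequencies are within the thresholds the direct feedback is off, so it tends to zero, and
frequency attractivity follows. The power imbalance `Dᵀ (f - f∞)` is slowly varying and drives the
vanishing frequencies, so it vanishes too (`tendsto_zero_of_slowly_varying`). Since `f - f∞`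
stays in the range of `Y_b D`, where `Dᵀ` is injective, `f` tends to `f∞`.

The equilibrium flow exists and is unique because the Laplacian `Dᵀ Y_b D` of a connected network
maps onto the balanced injections (`PowerNetwork.existsUnique_isEquilibriumFlow`).

Frequency invariance is a barrier argument: beyond a safe bound the direct feedback makes the
frequency return, whatever the rest of the network does. The open-loop system is the closed loop
without regions and controlled buses.
-/

/-! ### Calculus with a discrete set of exceptional times -/

/-- The mean value inequality for a continuous function whose derivative exists and is bounded above
by `C` outside a set that meets the interval in finitely many points. -/
theorem sub_le_mul_of_hasDerivAt_off_finite {g : ℝ → ℝ} {C : ℝ} {S : Set ℝ} {a b : ℝ}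
    (hS : (S ∩ Icc a b).Finite) (hab : a ≤ b) (hc : ContinuousOn g (Icc a b))
    (hd : ∀ t ∈ Ioo a b, t ∉ S → ∃ d, HasDerivAt g d t ∧ d ≤ C) :
    g b - g a ≤ C * (b - a) := by
  have key : ∀ F : Finset ℝ, ∀ a b : ℝ, a ≤ b → ContinuousOn g (Icc a b) →
      (∀ t ∈ Ioo a b, t ∉ F → ∃ d, HasDerivAt g d t ∧ d ≤ C) → g b - g a ≤ C * (b - a) := by
    intro F
    induction F using Finset.induction_on with
    | empty =>
      intro a b hab hc hd
      refine Convex.image_sub_le_mul_sub_of_deriv_le (convex_Icc a b) hc ?_ ?_ a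
        (left_mem_Icc.2 hab) b (right_mem_Icc.2 hab) hab
      · rw [interior_Icc]
        intro t ht
        obtain ⟨d, h, -⟩ := hd t ht (by simp)
        exact h.differentiableAt.differentiableWithinAt
      · rw [interior_Icc]
        intro t ht
        obtain ⟨d, h, hC⟩ := hd t ht (by simp)
        rwa [h.deriv]
    | insert x F _ ih =>
      intro a b hab hc hd
      by_cases hx : x ∈ Ioo a b
      · have h1 := ih a x hx.1.le (hc.mono (Icc_subset_Icc_right hx.2.le)) fun t ht htF =>
          hd t ⟨ht.1, ht.2.trans hx.2⟩ (by simp [htF, ht.2.ne])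
        have h2 := ih x b hx.2.le (hc.mono (Icc_subset_Icc_left hx.1.le)) fun t ht htF =>
          hd t ⟨hx.1.trans ht.1, ht.2⟩ (by simp [htF, ht.1.ne'])
        linarith
      · refine ih a b hab hc fun t ht htF => hd t ht ?_
        rw [Finset.mem_insert, not_or]
        exact ⟨fun h => hx (h ▸ ht), htF⟩
  refine key hS.toFinset a b hab hc fun t ht htF => hd t ht fun htS => htF ?_
  simpa using ⟨htS, ht.1.le, ht.2.le⟩

theorem abs_sub_le_mul_of_hasDerivAt_off_finite {g : ℝ → ℝ} {C : ℝ} {S : Set ℝ} {a b : ℝ}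
    (hS : (S ∩ Icc a b).Finite) (hab : a ≤ b) (hc : ContinuousOn g (Icc a b))
    (hd : ∀ t ∈ Ioo a b, t ∉ S → ∃ d, HasDerivAt g d t ∧ |d| ≤ C) :
    |g b - g a| ≤ C * (b - a) := by
  have h1 := sub_le_mul_of_hasDerivAt_off_finite hS hab hc (C := C) fun t ht htS => by
    obtain ⟨d, h, hC⟩ := hd t ht htS
    exact ⟨d, h, (abs_le.1 hC).2⟩
  have h2 := sub_le_mul_of_hasDerivAt_off_finite hS hab hc.neg (C := C) fun t ht htS => by
    obtain ⟨d, h, hC⟩ := hd t ht htS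
    exact ⟨-d, h.neg, by linarith [(abs_le.1 hC).1]⟩
  simp only [Pi.neg_apply] at h2
  exact abs_le.2 ⟨by linarith, h1⟩

/-- A continuous function that does not increase while it is above the level `c` cannot cross `c`
upwards. -/
theorem le_of_hasDerivAt_nonpos_above {g : ℝ → ℝ} {c : ℝ} {S : Set ℝ} {a b : ℝ}
    (hS : (S ∩ Icc a b).Finite) (hab : a ≤ b) (hc : ContinuousOn g (Icc a b)) (ha : g a ≤ c)
    (hd : ∀ t ∈ Ioo a b, t ∉ S → c < g t → ∃ d, HasDerivAt g d t ∧ d ≤ 0) : g b ≤ c := by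
  by_contra! hb
  have hcl : IsClosed (Icc a b ∩ g ⁻¹' Iic c) := hc.preimage_isClosed_of_isClosed isClosed_Icc
    isClosed_Iic
  have hcpt : IsCompact (Icc a b ∩ g ⁻¹' Iic c) :=
    isCompact_Icc.of_isClosed_subset hcl inter_subset_left
  -- the last time at which `g` is not above the level
  obtain ⟨σ, ⟨hσ, hgσ⟩, hmax⟩ := hcpt.exists_isGreatest ⟨a, left_mem_Icc.2 hab, ha⟩
  have h := sub_le_mul_of_hasDerivAt_off_finite (C := 0)
    (hS.subset (inter_subset_inter_right S (Icc_subset_Icc_left hσ.1))) hσ.2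
    (hc.mono (Icc_subset_Icc_left hσ.1)) fun t ht htS => by
      refine hd t ⟨hσ.1.trans_lt ht.1, ht.2⟩ htS ?_
      by_contra! hle
      exact absurd (hmax ⟨⟨hσ.1.trans ht.1.le, ht.2.le⟩, hle⟩) (not_le.2 ht.1)
  have : g σ ≤ c := hgσ
  linarith

/-- A version of Barbalat's lemma: if a nonnegative `U` decreases at the rate `c * y ^ 2` at least,
and `y` has a bounded derivative, then `y` tends to zero. -/
theorem tendsto_zero_of_dissipation {U y : ℝ → ℝ} {t0 c K : ℝ} {S : Set ℝ}
    (hS : ∀ a b, (S ∩ Icc a b).Finite) (hc : 0 < c) (hU : ∀ t, t0 ≤ t → 0 ≤ U t)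
    (hUc : ContinuousOn U (Ici t0))
    (hUd : ∀ t, t0 < t → t ∉ S → ∃ d, HasDerivAt U d t ∧ d ≤ -(c * y t ^ 2))
    (hyc : ContinuousOn y (Ici t0))
    (hyd : ∀ t, t0 < t → t ∉ S → ∃ d, HasDerivAt y d t ∧ |d| ≤ K) :
    Tendsto y atTop (𝓝 0) := by
  have hanti : Antitone fun t => U (max t0 t) := by
    intro s t hst
    have h := sub_le_mul_of_hasDerivAt_off_finite (hS (max t0 s) (max t0 t))
      (max_le_max_left t0 hst) (hUc.mono fun r hr => (le_max_left _ _).trans hr.1) (C := 0)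
      fun r hr hrS => by
        obtain ⟨d, h, hle⟩ := hUd r ((le_max_left _ _).trans_lt hr.1) hrS
        exact ⟨d, h, by nlinarith [sq_nonneg (y r)]⟩
    simp only
    linarith
  have hlim := tendsto_atTop_ciInf hanti
    ⟨0, by rintro _ ⟨t, rfl⟩; exact hU _ (le_max_left _ _)⟩
  generalize (⨅ t, U (max t0 t)) = l at hlim
  rw [Metric.tendsto_atTop]
  intro e he
  have hK : 0 < |K| + 1 := by positivity
  -- on an interval of length `h` the function `y` changes by at most `e / 2`
  set h := e / (2 * (|K| + 1)) with hh
  have hh0 : 0 < h := by positivity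
  have hKh : (|K| + 1) * h = e / 2 := by rw [hh]; field_simp
  obtain ⟨T, hT⟩ := (Metric.tendsto_atTop.1 hlim) (c * (e / 2) ^ 2 * h / 2) (by positivity)
  refine ⟨max T t0, fun t ht => ?_⟩
  have htT : T ≤ t := (le_max_left _ _).trans ht
  have ht0 : t0 ≤ t := (le_max_right _ _).trans ht
  rw [Real.dist_eq, sub_zero]
  by_contra! hy
  have hlow : ∀ r ∈ Icc t (t + h), (e / 2) ≤ |y r| := by
    intro r hr
    have h1 := abs_sub_le_mul_of_hasDerivAt_off_finite (hS t r) hr.1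
      (hyc.mono fun q hq => ht0.trans hq.1) (C := |K| + 1) fun q hq hqS => by
        obtain ⟨d, h, hle⟩ := hyd q (ht0.trans_lt hq.1) hqS
        exact ⟨d, h, by linarith [le_abs_self K]⟩
    have h2 : (|K| + 1) * (r - t) ≤ (|K| + 1) * h :=
      mul_le_mul_of_nonneg_left (by linarith [hr.2]) hK.le
    have h3 := abs_sub_abs_le_abs_sub (y t) (y r)
    rw [abs_sub_comm] at h3
    linarith
  have hdec := sub_le_mul_of_hasDerivAt_off_finite (hS t (t + h)) (by linarith)
    (hUc.mono fun q hq => ht0.trans hq.1) (C := -(c * (e / 2) ^ 2)) fun q hq hqS => by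
      obtain ⟨d, h, hle⟩ := hUd q (ht0.trans_lt hq.1) hqS
      refine ⟨d, h, hle.trans (neg_le_neg (mul_le_mul_of_nonneg_left ?_ hc.le))⟩
      rw [← sq_abs (y q)]
      exact pow_le_pow_left₀ (by positivity) (hlow q ⟨hq.1.le, hq.2.le⟩) 2
  have h1 := hT t htT
  have h2 := hT (t + h) (by linarith)
  rw [Real.dist_eq, max_eq_right ht0] at h1
  rw [Real.dist_eq, max_eq_right (by linarith)] at h2
  have := (abs_lt.1 h1).2
  have := (abs_lt.1 h2).1
  linarith

/-- If `z` tends to zero and `z' = ρ - q`, where `ρ` and `q'` tend to zero, then so does `q`: over a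
unit of time `q` is nearly constant, and `z` changes by nearly `-q`. -/
theorem tendsto_zero_of_slowly_varying {z q q' ρ : ℝ → ℝ} {t0 : ℝ} {S : Set ℝ}
    (hS : ∀ a b, (S ∩ Icc a b).Finite) (hz : Tendsto z atTop (𝓝 0)) (hρ : Tendsto ρ atTop (𝓝 0))
    (hq' : Tendsto q' atTop (𝓝 0))
    (hzc : ContinuousOn z (Ici t0)) (hqc : ContinuousOn q (Ici t0))
    (hzd : ∀ t, t0 < t → t ∉ S → HasDerivAt z (ρ t - q t) t)
    (hqd : ∀ t, t0 < t → t ∉ S → HasDerivAt q (q' t) t) :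
    Tendsto q atTop (𝓝 0) := by
  rw [Metric.tendsto_atTop]
  intro e he
  obtain ⟨T, hT⟩ := eventually_atTop.1
    (((Metric.tendsto_nhds.1 hz) (e / 5) (by positivity)).and
      (((Metric.tendsto_nhds.1 hρ) (e / 5) (by positivity)).and
        (((Metric.tendsto_nhds.1 hq') (e / 5) (by positivity)).and (eventually_ge_atTop t0))))
  simp only [Real.dist_eq, sub_zero] at hT ⊢
  refine ⟨T, fun t ht => ?_⟩
  have ht0 : t0 ≤ t := (hT t ht).2.2.2
  have hvar : ∀ r ∈ Icc t (t + 1), |q r - q t| ≤ e / 5 := by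
    intro r hr
    have h1 := abs_sub_le_mul_of_hasDerivAt_off_finite (hS t r) hr.1
      (hqc.mono fun q hq => ht0.trans hq.1) (C := e / 5) fun s hs hsS =>
        ⟨_, hqd s (ht0.trans_lt hs.1) hsS, (hT s (ht.trans hs.1.le)).2.2.1.le⟩
    have : e / 5 * (r - t) ≤ e / 5 * 1 :=
      mul_le_mul_of_nonneg_left (by linarith [hr.2]) (by positivity)
    linarith
  have h1 := abs_sub_le_mul_of_hasDerivAt_off_finite (g := fun s => z s + s * q t)
    (hS t (t + 1)) (by linarith)
    ((hzc.mono fun q hq => ht0.trans hq.1).add (by fun_prop)) (C := e / 5 + e / 5)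
    fun s hs hsS => by
      refine ⟨_, (hzd s (ht0.trans_lt hs.1) hsS).add ((hasDerivAt_id s).mul_const (q t)), ?_⟩
      have h2 := hvar s ⟨hs.1.le, hs.2.le⟩
      have h3 := (hT s (ht.trans hs.1.le)).2.1.le
      rw [abs_le] at h2 h3 ⊢
      constructor <;> linarith [h2.1, h2.2, h3.1, h3.2]
  have h2 := (hT t ht).1
  have h3 := (hT (t + 1) (by linarith)).1
  rw [abs_le] at h1
  rw [abs_lt] at h2 h3 ⊢
  constructor <;> linarith [h1.1, h1.2, h2.1, h2.2, h3.1, h3.2]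

theorem PiecewiseContinuous.exists_norm_le {E : Type*} [SeminormedAddCommGroup E] {p : ℝ → E}
    (hp : PiecewiseContinuous p) (τ : ℝ) : ∃ R, ∀ t ∈ Icc 0 τ, ‖p t‖ ≤ R := by
  refine isCompact_Icc.induction_on (p := fun s => ∃ R, ∀ t ∈ s, ‖p t‖ ≤ R) ⟨0, by simp⟩
    (fun s t hst ⟨R, hR⟩ => ⟨R, fun x hx => hR x (hst hx)⟩) ?_ ?_
  · rintro s t ⟨R, hR⟩ ⟨R', hR'⟩
    refine ⟨max R R', fun x hx => hx.elim (fun h => (hR x h).trans (le_max_left _ _))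
      fun h => (hR' x h).trans (le_max_right _ _)⟩
  · intro t ht
    obtain ⟨x, hx⟩ := hp.2.1 t ht.1
    have hr : ∀ᶠ s in 𝓝[>] t, ‖p s‖ ≤ ‖x‖ + 1 :=
      (hx.norm.eventually_lt_const (by linarith)).mono fun _ h => h.le
    have hl : ∃ R, ∀ᶠ s in 𝓝[Icc 0 τ ∩ Iio t] t, ‖p s‖ ≤ R := by
      rcases ht.1.eq_or_lt with h0 | h0
      · refine ⟨0, ?_⟩
        have : Icc 0 τ ∩ Iio t = ∅ := by
          ext s
          simp only [mem_inter_iff, mem_Icc, mem_Iio, mem_empty_iff_false, iff_false]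
          rintro ⟨⟨h1, -⟩, h2⟩
          linarith
        simp [this]
      · obtain ⟨y, hy⟩ := hp.2.2 t h0
        exact ⟨‖y‖ + 1, ((hy.norm.eventually_lt_const (by linarith)).mono
          fun _ h => h.le).filter_mono (nhdsWithin_mono _ inter_subset_right)⟩
    obtain ⟨R, hl⟩ := hl
    refine ⟨{s | ‖p s‖ ≤ max (max R (‖x‖ + 1)) ‖p t‖}, ?_, _, fun s hs => hs⟩
    rw [mem_nhdsWithin_iff_eventually]
    rw [eventually_nhdsWithin_iff] at hl hr
    filter_upwards [hl, hr] with s h1 h2 hs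
    rcases lt_trichotomy s t with h | h | h
    · exact (h1 ⟨hs, h⟩).trans ((le_max_left _ _).trans (le_max_left _ _))
    · subst h; exact le_max_right _ _
    · exact (h2 h).trans ((le_max_right _ _).trans (le_max_left _ _))

/-- The positive times at which the injection jumps or a region takes a sample. -/
def switchingTimes {X : Type*} [TopologicalSpace X] {ι : Type*} (p : ℝ → X) (Δ : ι → ℕ → ℝ) :
    Set ℝ :=
  {t | 0 < t ∧ (¬ ContinuousAt p t ∨ ∃ β j, t = Δ β j)}

theorem switchingTimes_inter_Icc_finite {X : Type*} [TopologicalSpace X] {ι : Type*} [Finite ι]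
    {p : ℝ → X} {Δ : ι → ℕ → ℝ} (hp : PiecewiseContinuous p)
    (hΔ : ∀ β, Tendsto (Δ β) atTop atTop) (a b : ℝ) : (switchingTimes p Δ ∩ Icc a b).Finite := by
  obtain ⟨S, hS, hcont⟩ := hp.1
  have hfin : ∀ β, {j | Δ β j ≤ b}.Finite := fun β => by
    have := (hΔ β).eventually_gt_atTop b
    rw [← Nat.cofinite_eq_atTop, eventually_cofinite] at this
    simpa using this
  refine ((hS b).union (finite_iUnion fun β => (hfin β).image (Δ β))).subset ?_
  rintro t ⟨⟨ht, h⟩, -, htb⟩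
  rcases h with h | ⟨β, j, rfl⟩
  · refine Or.inl ⟨?_, ht.le, htb⟩
    by_contra htS
    exact h ((hcont t ht.le htS).continuousAt (Ici_mem_nhds ht))
  · exact Or.inr (mem_iUnion.2 ⟨β, j, htb, rfl⟩)

noncomputable section

/-! ### Finite families of reals -/

theorem exists_pos_le {ι : Type*} [Finite ι] (g : ι → ℝ) (hg : ∀ i, 0 < g i) :
    ∃ μ : ℝ, 0 < μ ∧ ∀ i, μ ≤ g i := by
  rcases isEmpty_or_nonempty ι with h | h
  · exact ⟨1, one_pos, fun i => h.elim i⟩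
  · obtain ⟨i, hi⟩ := Finite.exists_min g
    exact ⟨g i, hg i, hi⟩

/-- A bound for all coordinates bounds the supremum norm. -/
theorem mul_norm_sq_le {ι : Type*} [Fintype ι] {m B : ℝ} (hm : 0 ≤ m) (x : ι → ℝ) (hB : 0 ≤ B)
    (h : ∀ i, m * x i ^ 2 ≤ B) : m * ‖x‖ ^ 2 ≤ B := by
  rcases isEmpty_or_nonempty ι with hι | hι
  · simpa [Subsingleton.elim x 0] using hB
  · obtain ⟨i, hi⟩ := Finite.exists_max fun i => |x i|
    have hx : ‖x‖ ≤ |x i| := (pi_norm_le_iff_of_nonneg (abs_nonneg _)).2 hi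
    refine le_trans ?_ (h i)
    rw [← sq_abs (x i)]
    exact mul_le_mul_of_nonneg_left (pow_le_pow_left₀ (norm_nonneg _) hx 2) hm

theorem sq_le_sq_of_norm_le {ι : Type*} [Fintype ι] {y : ι → ℝ} {ρ : ℝ} (h : ‖y‖ ≤ ρ) (i : ι) :
    y i ^ 2 ≤ ρ ^ 2 := by
  rw [← sq_abs]
  exact pow_le_pow_left₀ (abs_nonneg _) ((norm_le_pi_norm y i).trans h) 2

/-! ### The network: incidence, Laplacian and equilibrium flows -/

namespace PowerNetwork

variable {V L : Type*} (net : PowerNetwork V L)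

theorem diff_apply [Fintype V] [DecidableEq V] (w : V → ℝ) (e : L) :
    net.diff w e = w (net.pos e) - w (net.neg e) := by
  have h : ∀ i, net.incidence e i * w i =
      (if i = net.pos e then w i else 0) - if i = net.neg e then w i else 0 := by
    intro i
    by_cases h1 : i = net.pos e
    · have h2 : i ≠ net.neg e := fun h2 => net.pos_ne_neg e (h1.symm.trans h2)
      simp [incidence, h1, net.pos_ne_neg e]
    · simp only [incidence, Matrix.of_apply, h1, if_false]
      split_ifs <;> simp
  simp [diff, Matrix.mulVec, dotProduct, h, Finset.sum_sub_distrib]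

theorem sum_mul_diff [Fintype V] [DecidableEq V] [Fintype L] (x : L → ℝ) (w : V → ℝ) :
    ∑ e, x e * net.diff w e = ∑ i, w i * net.outflow x i := by
  have h : x ⬝ᵥ net.incidence.mulVec w = w ⬝ᵥ net.incidence.transpose.mulVec x := by
    rw [Matrix.dotProduct_mulVec, Matrix.mulVec_transpose, dotProduct_comm]
  exact h

/-- `f ↦ Dᵀ f` as a linear map. -/
def outflowₗ [DecidableEq V] [Fintype L] : (L → ℝ) →ₗ[ℝ] (V → ℝ) :=
  net.incidence.transpose.mulVecLin

/-- `θ ↦ Y_b D θ` as a linear map. -/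
def flowₗ [Fintype V] [DecidableEq V] : (V → ℝ) →ₗ[ℝ] (L → ℝ) where
  toFun θ e := net.susceptance e * net.diff θ e
  map_add' θ η := by ext e; simp only [diff_apply, Pi.add_apply]; ring
  map_smul' c θ := by
    ext e; simp only [diff_apply, Pi.smul_apply, smul_eq_mul, RingHom.id_apply]; ring

theorem outflowₗ_apply [DecidableEq V] [Fintype L] (f : L → ℝ) :
    net.outflowₗ f = net.outflow f := rfl

theorem flowₗ_apply [Fintype V] [DecidableEq V] (θ : V → ℝ) (e : L) :
    net.flowₗ θ e = net.susceptance e * net.diff θ e := rfl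

theorem outflow_sub [DecidableEq V] [Fintype L] (f g : L → ℝ) :
    net.outflow (f - g) = net.outflow f - net.outflow g :=
  map_sub net.outflowₗ f g

theorem outflow_add [DecidableEq V] [Fintype L] (f g : L → ℝ) :
    net.outflow (f + g) = net.outflow f + net.outflow g :=
  map_add net.outflowₗ f g

theorem sum_outflow [Fintype V] [DecidableEq V] [Fintype L] (f : L → ℝ) :
    ∑ i, net.outflow f i = 0 := by
  have h := net.sum_mul_diff f 1
  simpa [diff_apply] using h.symm

/-- The kernel of the Laplacian is that of `D`, since `θᵀ Dᵀ Y_b D θ = ∑ bₑ (D θ)ₑ²`. -/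
theorem diff_eq_zero_of_outflow_flow_eq_zero [Fintype V] [DecidableEq V] [Fintype L] {θ : V → ℝ}
    (h : net.outflow (net.flowₗ θ) = 0) (e : L) : net.diff θ e = 0 := by
  have h1 := net.sum_mul_diff (net.flowₗ θ) θ
  simp only [h, Pi.zero_apply, mul_zero, Finset.sum_const_zero, flowₗ_apply] at h1
  have h2 := (Finset.sum_eq_zero_iff_of_nonneg fun e _ => by
    have := (net.susceptance_pos e).le
    rw [mul_assoc]
    exact mul_nonneg this (mul_self_nonneg _)).1 h1 e (Finset.mem_univ e)
  rw [mul_assoc] at h2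
  exact mul_self_eq_zero.1 ((mul_eq_zero.1 h2).resolve_left (net.susceptance_pos e).ne')

/-- `Dᵀ` is injective on the range of `Y_b D`. -/
theorem flow_eq_zero_of_outflow_eq_zero [Fintype V] [DecidableEq V] [Fintype L] {θ : V → ℝ}
    (h : net.outflow (net.flowₗ θ) = 0) : net.flowₗ θ = 0 := by
  ext e
  simp [flowₗ_apply, net.diff_eq_zero_of_outflow_flow_eq_zero h e]

theorem eq_of_diff_eq_zero [Fintype V] [DecidableEq V] (hconn : net.graph.Connected) {θ : V → ℝ}
    (h : ∀ e, net.diff θ e = 0) (i j : V) : θ i = θ j := by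
  obtain ⟨q⟩ := hconn.preconnected i j
  induction q with
  | nil => rfl
  | cons hadj _ ih =>
    refine Eq.trans ?_ ih
    rw [graph, SimpleGraph.fromEdgeSet_adj] at hadj
    obtain ⟨⟨e, he⟩, -⟩ := hadj
    have h0 := h e
    rw [diff_apply] at h0
    rcases Sym2.eq_iff.1 he with ⟨h1, h2⟩ | ⟨h1, h2⟩ <;> rw [← h1, ← h2] <;> linarith

/-- On a connected network the Laplacian `Dᵀ Y_b D` reaches every balanced injection. -/
theorem exists_outflow_flow_eq [Fintype V] [DecidableEq V] [Fintype L]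
    (hconn : net.graph.Connected) {q : V → ℝ} (hq : ∑ i, q i = 0) :
    ∃ θ, net.outflow (net.flowₗ θ) = q := by
  have := hconn.nonempty
  -- adding the matrix of ones to the Laplacian makes it invertible
  let Λ : (V → ℝ) →ₗ[ℝ] (V → ℝ) := net.outflowₗ ∘ₗ net.flowₗ +
    LinearMap.pi fun _ => ∑ i, LinearMap.proj i
  have hΛ : ∀ θ i, Λ θ i = net.outflow (net.flowₗ θ) i + ∑ j, θ j := by
    intro θ i
    simp [Λ, outflowₗ_apply]
  have hsum : ∀ θ, ∑ i, Λ θ i = 0 → ∑ j, θ j = 0 := by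
    intro θ h
    simp only [hΛ, Finset.sum_add_distrib, sum_outflow, zero_add, Finset.sum_const,
      Finset.card_univ, nsmul_eq_mul] at h
    exact (mul_eq_zero.1 h).resolve_left (Nat.cast_ne_zero.2 Fintype.card_ne_zero)
  have hinj : Function.Injective Λ := by
    rw [← LinearMap.ker_eq_bot, LinearMap.ker_eq_bot']
    intro θ h
    have h0 : ∑ j, θ j = 0 := hsum θ (by simp [h])
    have h1 : net.outflow (net.flowₗ θ) = 0 := by
      ext i
      have := hΛ θ i
      rw [h, h0] at this
      simpa using this.symm
    have h2 := net.eq_of_diff_eq_zero hconn (net.diff_eq_zero_of_outflow_flow_eq_zero h1)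
    ext i
    rw [Finset.sum_congr rfl fun j _ => h2 j i] at h0
    simpa using h0
  obtain ⟨θ, hθ⟩ := (LinearMap.injective_iff_surjective.1 hinj) q
  refine ⟨θ, ?_⟩
  ext i
  have := hΛ θ i
  rw [hsum θ (by rw [hθ, hq]), hθ] at this
  simpa using this.symm

theorem isEquilibriumFlow_iff [Fintype V] [DecidableEq V] [Fintype L]
    {pstar : V → ℝ} {f0 finf : L → ℝ} :
    net.IsEquilibriumFlow pstar f0 finf ↔
      net.outflow finf = pstar ∧ finf - f0 ∈ LinearMap.range net.flowₗ := by
  refine and_congr_right fun _ => exists_congr fun θ => ?_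
  simp only [funext_iff, flowₗ_apply, Pi.sub_apply]
  exact forall_congr' fun e => by constructor <;> intro h <;> linarith

theorem existsUnique_isEquilibriumFlow [Fintype V] [DecidableEq V] [Fintype L]
    (hconn : net.graph.Connected) {pstar : V → ℝ} (hbal : ∑ i, pstar i = 0) (f0 : L → ℝ) :
    ∃! finf, net.IsEquilibriumFlow pstar f0 finf := by
  simp only [isEquilibriumFlow_iff]
  obtain ⟨θ, hθ⟩ := net.exists_outflow_flow_eq hconn (q := pstar - net.outflow f0)
    (by simp [hbal, sum_outflow])
  refine ⟨f0 + net.flowₗ θ, ⟨by rw [outflow_add, hθ]; abel, θ, by abel⟩, ?_⟩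
  rintro g ⟨hg, η, hη⟩
  have h := net.flow_eq_zero_of_outflow_eq_zero (θ := η - θ) (by
    rw [map_sub, outflow_sub, hθ, hη, outflow_sub, hg]; abel)
  rw [map_sub, hη, sub_sub, sub_eq_zero] at h
  exact h

/-- In the range of `Y_b D` a flow can be recovered continuously from its outflows. -/
theorem tendsto_zero_of_outflow [Fintype V] [DecidableEq V] [Fintype L]
    {ι : Type*} {l : Filter ι} {x : ι → L → ℝ}
    (hx : ∀ᶠ t in l, x t ∈ LinearMap.range net.flowₗ)
    (h : Tendsto (fun t => net.outflow (x t)) l (𝓝 0)) : Tendsto x l (𝓝 0) := by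
  let R := LinearMap.range net.flowₗ
  obtain ⟨g, hg⟩ := (net.outflowₗ ∘ₗ R.subtype).exists_leftInverse_of_injective (by
    rw [LinearMap.ker_eq_bot']
    rintro ⟨_, θ, rfl⟩ h0
    exact Subtype.ext (net.flow_eq_zero_of_outflow_eq_zero h0))
  have hcont : Continuous (R.subtype ∘ₗ g) := LinearMap.continuous_of_finiteDimensional _
  have h1 := (hcont.tendsto 0).comp h
  rw [map_zero] at h1
  refine h1.congr' (hx.mono fun t ht => ?_)
  have := LinearMap.congr_fun hg ⟨x t, ht⟩
  simpa [outflowₗ_apply] using congrArg Subtype.val this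

/-! ### The energy function -/

/-- Kinetic energy plus the energies of the lines and of the low-pass filters; `x` is the deviation
of the flow from a reference flow. -/
def energy [Fintype V] [Fintype L] (x : L → ℝ) (w a : V → ℝ) : ℝ :=
  (∑ i, net.inertia i * w i ^ 2 + ∑ e, x e ^ 2 / net.susceptance e + ∑ i, a i ^ 2) / 2

theorem energy_nonneg [Fintype V] [Fintype L] (x : L → ℝ) (w a : V → ℝ) : 0 ≤ net.energy x w a := by
  have h1 := fun i => (net.inertia_pos i).le
  have h2 := fun i => (net.susceptance_pos i).le
  exact div_nonneg (add_nonneg (add_nonneg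
    (Finset.sum_nonneg fun i _ => mul_nonneg (h1 i) (sq_nonneg _))
    (Finset.sum_nonneg fun i _ => div_nonneg (sq_nonneg _) (h2 i)))
    (Finset.sum_nonneg fun i _ => sq_nonneg _)) zero_le_two

/-- The energy is small, or bounded, only if the state is: it dominates a positive multiple of the
squared norm. -/
theorem exists_norm_sq_le_energy [Fintype V] [Fintype L] : ∃ μ : ℝ, 0 < μ ∧
    ∀ (x : L → ℝ) (w a : V → ℝ), μ * ‖x‖ ^ 2 ≤ net.energy x w a ∧ μ * ‖w‖ ^ 2 ≤ net.energy x w a ∧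
      μ * ‖a‖ ^ 2 ≤ net.energy x w a := by
  obtain ⟨μ₁, h₁, hM⟩ := exists_pos_le net.inertia net.inertia_pos
  obtain ⟨μ₂, h₂, hB⟩ := exists_pos_le (fun e => 1 / net.susceptance e)
    fun e => one_div_pos.2 (net.susceptance_pos e)
  have hm : 0 < min 1 (min μ₁ μ₂) := lt_min one_pos (lt_min h₁ h₂)
  refine ⟨min 1 (min μ₁ μ₂) / 2, by positivity, fun x w a => ?_⟩
  set m := min 1 (min μ₁ μ₂)
  have hm1 : m ≤ 1 := min_le_left _ _
  have hmM : m ≤ μ₁ := (min_le_right _ _).trans (min_le_left _ _)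
  have hmB : m ≤ μ₂ := (min_le_right _ _).trans (min_le_right _ _)
  have n1 : ∀ i, 0 ≤ net.inertia i * w i ^ 2 := fun i =>
    mul_nonneg (net.inertia_pos i).le (sq_nonneg _)
  have n2 : ∀ e, 0 ≤ x e ^ 2 / net.susceptance e := fun e =>
    div_nonneg (sq_nonneg _) (net.susceptance_pos e).le
  have n3 : ∀ i, 0 ≤ a i ^ 2 := fun i => sq_nonneg _
  have s1 := Finset.sum_nonneg fun i (_ : i ∈ Finset.univ) => n1 i
  have s2 := Finset.sum_nonneg fun i (_ : i ∈ Finset.univ) => n2 i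
  have s3 := Finset.sum_nonneg fun i (_ : i ∈ Finset.univ) => n3 i
  refine ⟨?_, ?_, ?_⟩
  · have h := mul_norm_sq_le hm.le x s2 fun e => by
      refine le_trans ?_ (Finset.single_le_sum (fun e _ => n2 e) (Finset.mem_univ e))
      rw [div_eq_mul_one_div, mul_comm]
      exact mul_le_mul_of_nonneg_left (hmB.trans (hB e)) (sq_nonneg _)
    unfold energy
    linarith
  · have h := mul_norm_sq_le hm.le w s1 fun i => by
      refine le_trans ?_ (Finset.single_le_sum (fun i _ => n1 i) (Finset.mem_univ i))
      exact mul_le_mul_of_nonneg_right (hmM.trans (hM i)) (sq_nonneg _)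
    unfold energy
    linarith
  · have h := mul_norm_sq_le hm.le a s3 fun i => by
      refine le_trans ?_ (Finset.single_le_sum (fun i _ => n3 i) (Finset.mem_univ i))
      exact (mul_le_mul_of_nonneg_right hm1 (sq_nonneg _)).trans (one_mul _).le
    unfold energy
    linarith

/-- The energy is small near the equilibrium. -/
theorem exists_energy_le_mul_sq [Fintype V] [Fintype L] : ∃ ν : ℝ, 0 < ν ∧
    ∀ (x : L → ℝ) (w a : V → ℝ) (ρ : ℝ), ‖x‖ ≤ ρ → ‖w‖ ≤ ρ → ‖a‖ ≤ ρ →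
      net.energy x w a ≤ ν * ρ ^ 2 := by
  have n1 := Finset.sum_nonneg fun i (_ : i ∈ Finset.univ) => (net.inertia_pos i).le
  have n2 := Finset.sum_nonneg fun e (_ : e ∈ Finset.univ) =>
    (one_div_pos.2 (net.susceptance_pos e)).le
  refine ⟨∑ i, net.inertia i + ∑ e, 1 / net.susceptance e + ∑ _i : V, (1 : ℝ) + 1, by positivity,
    fun x w a ρ hx hw ha => ?_⟩
  have s1 : ∑ i, net.inertia i * w i ^ 2 ≤ (∑ i, net.inertia i) * ρ ^ 2 := by
    rw [Finset.sum_mul]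
    exact Finset.sum_le_sum fun i _ =>
      mul_le_mul_of_nonneg_left (sq_le_sq_of_norm_le hw i) (net.inertia_pos i).le
  have s2 : ∑ e, x e ^ 2 / net.susceptance e ≤ (∑ e, 1 / net.susceptance e) * ρ ^ 2 := by
    rw [Finset.sum_mul]
    refine Finset.sum_le_sum fun e _ => ?_
    rw [one_div_mul_eq_div]
    exact div_le_div_of_nonneg_right (sq_le_sq_of_norm_le hx e) (net.susceptance_pos e).le
  have s3 : ∑ i, a i ^ 2 ≤ (∑ _i : V, (1 : ℝ)) * ρ ^ 2 := by
    rw [Finset.sum_mul]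
    refine Finset.sum_le_sum fun i _ => ?_
    rw [one_mul]
    exact sq_le_sq_of_norm_le ha i
  have h0 := net.energy_nonneg x w a
  have := sq_nonneg ρ
  unfold energy at h0 ⊢
  linarith

/-- The rate of change of the energy is bounded by the dissipation of the dampings, plus the power
of the injection in excess of the reference, minus the dissipation of the filters, provided that the
control is `y + a` with `y` opposed to the frequency and each filter decays at the rate `κ i` up to
the term `-w i`, which cancels the power of `a`. -/
theorem exists_hasDerivAt_energy_le [Fintype V] [DecidableEq V] [Fintype L] {f : ℝ → L → ℝ}
    {w a : ℝ → V → ℝ} {t : ℝ} {w' a' p y κ : V → ℝ} (fref : L → ℝ)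
    (hf : HasDerivAt f (fun e => net.susceptance e * net.diff (w t) e) t) (hw : HasDerivAt w w' t)
    (hw' : ∀ i, net.inertia i * w' i =
      -(net.damping i * w t i) - net.outflow (f t) i + p i + (y i + a t i))
    (hy : ∀ i, w t i * y i ≤ 0) (ha : HasDerivAt a a' t)
    (ha' : ∀ i, a t i * a' i ≤ -(w t i * a t i) - κ i * a t i ^ 2) :
    ∃ d, HasDerivAt (fun s => net.energy (f s - fref) (w s) (a s)) d t ∧
      d ≤ ∑ i, (w t i * (p i - net.outflow fref i) - net.damping i * w t i ^ 2 -
        κ i * a t i ^ 2) := by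
  rw [hasDerivAt_pi] at hf hw ha
  have h1 := HasDerivAt.fun_sum fun i (_ : i ∈ Finset.univ) =>
    ((hw i).pow 2).const_mul (net.inertia i)
  have h2 := HasDerivAt.fun_sum fun e (_ : e ∈ Finset.univ) =>
    (((hf e).sub_const (fref e)).pow 2).div_const (net.susceptance e)
  have h3 := HasDerivAt.fun_sum fun i (_ : i ∈ Finset.univ) => (ha i).pow 2
  refine ⟨_, ((h1.add h2).add h3).div_const 2, ?_⟩
  have hflow : ∑ e, (f t e - fref e) * net.diff (w t) e =
      ∑ i, w t i * (net.outflow (f t) i - net.outflow fref i) := by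
    have := net.sum_mul_diff (f t - fref) (w t)
    simpa only [outflow_sub, Pi.sub_apply] using this
  have e2 : ∀ e, (2 : ℕ) * (f t e - fref e) ^ (2 - 1) *
      (net.susceptance e * net.diff (w t) e) / net.susceptance e =
        2 * ((f t e - fref e) * net.diff (w t) e) := by
    intro e
    have := (net.susceptance_pos e).ne'
    field_simp
    simp
    ring
  simp only [e2]
  rw [← Finset.mul_sum, hflow, Finset.mul_sum, ← Finset.sum_add_distrib, ← Finset.sum_add_distrib,
    Finset.sum_div]
  refine Finset.sum_le_sum fun i _ => ?_
  have := hy i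
  have := ha' i
  have : w t i * (net.inertia i * w' i) = w t i *
    (-(net.damping i * w t i) - net.outflow (f t) i + p i + (y i + a t i)) := by rw [hw']
  norm_num
  linarith

end PowerNetwork

/-! ### The controller -/

theorem abs_sat_le {a m : ℝ} (hm : 0 ≤ m) : |sat a m (-m)| ≤ m := by
  unfold sat
  split_ifs with h1 h2
  · rw [abs_of_nonneg hm]
  · rw [abs_neg, abs_of_nonneg hm]
  · exact abs_le.2 ⟨(not_le.1 h2).le, (not_le.1 h1).le⟩

namespace PowerNetwork

section DirectFeedback

variable {V L : Type*} [DecidableEq V] [Fintype L] (net : PowerNetwork V L) {C : ControlDesign V}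
  (f : L → ℝ) (w p a : V → ℝ) {i : V}

theorem mul_directFeedback_nonpos : w i * net.directFeedback C f w p a i ≤ 0 := by
  unfold directFeedback
  split_ifs with h1 h2 h3
  · exact mul_nonpos_of_nonneg_of_nonpos ((C.thrhi_pos i h1).trans h2).le (min_le_left _ _)
  · exact mul_nonpos_of_nonpos_of_nonneg (h3.trans (C.thrlo_neg i h1)).le (le_max_left _ _)
  · simp
  · simp

/-- The quotient in the direct feedback is large only with the sign that deactivates it, since the
frequency bounds lie beyond the thresholds. -/
theorem abs_directFeedback_le :
    |net.directFeedback C f w p a i| ≤ |C.γhi i| + |C.γlo i| + |net.feedbackTerm f w p a i| := by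
  have hb : ∀ {γ x y : ℝ}, 0 < γ → 0 < y → -y ≤ x → -γ ≤ γ * x / y := by
    intro γ x y hγ hy hx
    rw [le_div_iff₀ hy]
    nlinarith
  have h0 : 0 ≤ |C.γhi i| + |C.γlo i| + |net.feedbackTerm f w p a i| := by positivity
  have hv := neg_abs_le (net.feedbackTerm f w p a i)
  have hv' := le_abs_self (net.feedbackTerm f w p a i)
  unfold directFeedback
  split_ifs with h1 h2 h3
  · have := hb (x := C.whi i - w i) (C.γhi_pos i h1) (sub_pos.2 h2) (by linarith [C.lt_whi i h1])
    have := le_abs_self (C.γhi i)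
    have := abs_nonneg (C.γlo i)
    rw [abs_of_nonpos (min_le_left _ _), neg_le]
    exact le_min (by linarith) (by linarith)
  · have := hb (x := w i - C.wlo i) (C.γlo_pos i h1) (sub_pos.2 h3) (by linarith [C.wlo_lt i h1])
    have := le_abs_self (C.γlo i)
    have := abs_nonneg (C.γhi i)
    have e : C.γlo i * (C.wlo i - w i) / (C.thrlo i - w i) =
        -(C.γlo i * (w i - C.wlo i) / (C.thrlo i - w i)) := by ring
    rw [abs_of_nonneg (le_max_left _ _), e]
    exact max_le (by linarith) (by linarith)
  · simpa using h0
  · simpa using h0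

theorem directFeedback_eq_zero (h : i ∈ C.Iw → C.thrlo i ≤ w i ∧ w i ≤ C.thrhi i) :
    net.directFeedback C f w p a i = 0 := by
  unfold directFeedback
  split_ifs with h1 h2 h3
  · exact absurd h2 (not_lt.2 (h h1).2)
  · exact absurd h3 (not_lt.2 (h h1).1)
  · rfl
  · rfl

/-- Above the upper safe bound the direct feedback makes the frequency decrease. -/
theorem directFeedback_le_feedbackTerm (hi : i ∈ C.Iw) (h : C.whi i ≤ w i) :
    net.directFeedback C f w p a i ≤ net.feedbackTerm f w p a i := by
  have hthr := (C.lt_whi i hi).trans_le h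
  rw [directFeedback, if_pos hi, if_pos hthr]
  refine (min_le_right _ _).trans (add_le_of_nonpos_left ?_)
  exact div_nonpos_of_nonpos_of_nonneg
    (mul_nonpos_of_nonneg_of_nonpos (C.γhi_pos i hi).le (sub_nonpos.2 h)) (sub_pos.2 hthr).le

/-- Below the lower safe bound the direct feedback makes the frequency increase. -/
theorem feedbackTerm_le_directFeedback (hi : i ∈ C.Iw) (h : w i ≤ C.wlo i) :
    net.feedbackTerm f w p a i ≤ net.directFeedback C f w p a i := by
  have hthr := h.trans_lt (C.wlo_lt i hi)
  have hhi := (hthr.trans (C.thrlo_neg i hi)).trans (C.thrhi_pos i hi)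
  rw [directFeedback, if_pos hi, if_neg (not_lt.2 hhi.le), if_pos hthr]
  refine (le_add_of_nonneg_left ?_).trans (le_max_right _ _)
  exact div_nonneg (mul_nonneg (C.γlo_pos i hi).le (sub_nonneg.2 h)) (sub_pos.2 hthr).le

/-- Once the frequencies are within the thresholds, the direct feedback is switched off. -/
theorem tendsto_directFeedback {ι : Type*} {l : Filter ι} {f : ι → L → ℝ} {w p a : ι → V → ℝ}
    (hw : Tendsto w l (𝓝 0)) :
    Tendsto (fun t => net.directFeedback C (f t) (w t) (p t) (a t)) l (𝓝 0) := by
  refine tendsto_pi_nhds.2 fun i => tendsto_const_nhds.congr' ?_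
  have hi := tendsto_pi_nhds.1 hw i
  by_cases hiw : i ∈ C.Iw
  · filter_upwards [hi.eventually_const_le (C.thrlo_neg i hiw),
      hi.eventually_le_const (C.thrhi_pos i hiw)] with t h1 h2
    exact (net.directFeedback_eq_zero _ _ _ _ fun _ => ⟨h1, h2⟩).symm
  · exact Eventually.of_forall fun t =>
      (net.directFeedback_eq_zero _ _ _ _ fun h => absurd h hiw).symm

end DirectFeedback

/-! ### Closed-loop trajectories -/

namespace IsClosedLoopTrajectory

variable {V L : Type*} [Fintype V] [Fintype L] [DecidableEq V] {net : PowerNetwork V L}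
  {C : ControlDesign V} {p : ℝ → V → ℝ} {pf : ℝ → ℝ → V → ℝ} {r : ℕ} {s : Fin r → Finset V}
  {Δ : Fin r → ℕ → ℝ} {J : Set ℝ} {f : ℝ → L → ℝ} {w a u : ℝ → V → ℝ}

theorem dynamicsAt (h : net.IsClosedLoopTrajectory C p pf s Δ J f w a u) {t : ℝ}
    (ht : t ∈ interior J) (ht0 : 0 < t) (htS : t ∉ switchingTimes p Δ) :
    net.DynamicsAt p (fun t i => net.directFeedback C (f t) (w t) (p t) (a t) i + a t i) f w t := by
  simp only [switchingTimes, mem_ofPred_eq, not_and_or, not_or, not_not, not_exists] at htS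
  exact h.dynamics t ht (htS.resolve_left (not_not.2 ht0)).1 (htS.resolve_left (not_not.2 ht0)).2

/-- Off the switching times all filter states are differentiable; those of uncontrolled buses
vanish. -/
theorem exists_hasDerivAt_filter (h : net.IsClosedLoopTrajectory C p pf s Δ J f w a u) {t : ℝ}
    (ht : t ∈ interior J) (ht0 : 0 < t) (htS : t ∉ switchingTimes p Δ) :
    ∃ a', HasDerivAt a a' t ∧ (∀ i ∈ C.Iu, a' i =
      -(a t i / C.Tf i) - w t i + C.stabilityFilter (a t) (u t) i) ∧ ∀ i ∉ C.Iu, a' i = 0 := by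
  simp only [switchingTimes, mem_ofPred_eq, not_and_or, not_or, not_not, not_exists] at htS
  obtain ⟨h1, h2⟩ := htS.resolve_left (not_not.2 ht0)
  refine ⟨fun i => if i ∈ C.Iu then
    -(a t i / C.Tf i) - w t i + C.stabilityFilter (a t) (u t) i else 0,
    hasDerivAt_pi.2 fun i => ?_, fun i hi => if_pos hi, fun i hi => if_neg hi⟩
  split_ifs with hi
  · exact h.filter t ht h1 h2 i hi
  · refine (hasDerivAt_const t (0 : ℝ)).congr_of_eventuallyEq ?_
    filter_upwards [mem_interior_iff_mem_nhds.1 ht] with t' ht' using h.filter_zero t' ht' i hi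

/-- The energy balance in closed loop. The direct feedback opposes the frequencies, the power of the
bottom layer control is drawn from the filter states, and `ε i * Tf i < 1` lets the leakage of each
filter dominate its saturated input, whatever the MPC component computes. -/
theorem exists_hasDerivAt_energy (h : net.IsClosedLoopTrajectory C p pf s Δ J f w a u) {t : ℝ}
    (ht : t ∈ interior J) (ht0 : 0 < t) (htS : t ∉ switchingTimes p Δ) (fref : L → ℝ) :
    ∃ d, HasDerivAt (fun s => net.energy (f s - fref) (w s) (a s)) d t ∧
      d ≤ ∑ i, (w t i * (p t i - net.outflow fref i) - net.damping i * w t i ^ 2 -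
        (1 / C.Tf i - C.ε i) * a t i ^ 2) := by
  obtain ⟨hf, w', hw, hw'⟩ := h.dynamicsAt ht ht0 htS
  obtain ⟨a', ha, ha1, ha2⟩ := h.exists_hasDerivAt_filter ht ht0 htS
  refine net.exists_hasDerivAt_energy_le fref hf hw hw'
    (fun i => net.mul_directFeedback_nonpos _ _ _ _) ha fun i => ?_
  by_cases hi : i ∈ C.Iu
  · have h1 : |C.stabilityFilter (a t) (u t) i| ≤ C.ε i * |a t i| :=
      abs_sat_le (mul_nonneg (C.ε_pos i hi).le (abs_nonneg _))
    have h2 : a t i * C.stabilityFilter (a t) (u t) i ≤ C.ε i * a t i ^ 2 := by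
      calc a t i * C.stabilityFilter (a t) (u t) i
          ≤ |a t i| * |C.stabilityFilter (a t) (u t) i| := by
            rw [← abs_mul]; exact le_abs_self _
        _ ≤ |a t i| * (C.ε i * |a t i|) := mul_le_mul_of_nonneg_left h1 (abs_nonneg _)
        _ = C.ε i * a t i ^ 2 := by rw [← sq_abs (a t i)]; ring
    rw [ha1 i hi]
    have e : a t i * (-(a t i / C.Tf i) - w t i + C.stabilityFilter (a t) (u t) i) =
      -(w t i * a t i) - 1 / C.Tf i * a t i ^ 2 + a t i * C.stabilityFilter (a t) (u t) i := by ring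
    linarith
  · simp [h.filter_zero t (interior_subset ht) i hi]

/-- Frequency invariance. -/
theorem freq_mem_Icc (h : net.IsClosedLoopTrajectory C p pf s Δ J f w a u)
    (hS : ∀ a b, (switchingTimes p Δ ∩ Icc a b).Finite) {t : ℝ} (ht : 0 ≤ t) (hJ : Icc 0 t ⊆ J)
    {i : V} (hi : i ∈ C.Iw) (h0 : w 0 i ∈ Icc (C.wlo i) (C.whi i)) :
    w t i ∈ Icc (C.wlo i) (C.whi i) := by
  have hint : Ioo 0 t ⊆ interior J := by
    rw [← interior_Icc]
    exact interior_mono hJ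
  have hc : ContinuousOn (fun t => w t i) (Icc 0 t) :=
    (continuousOn_pi.1 h.continuous_freq i).mono hJ
  constructor
  · refine neg_le_neg_iff.1 (le_of_hasDerivAt_nonpos_above (g := fun t => -w t i) (hS 0 t) ht
      hc.neg (neg_le_neg h0.1) fun τ hτ hτS hlt => ?_)
    obtain ⟨-, w', hw, hw'⟩ := h.dynamicsAt (hint hτ) hτ.1 hτS
    refine ⟨_, (hasDerivAt_pi.1 hw i).neg, neg_nonpos.2 ?_⟩
    have h1 := net.feedbackTerm_le_directFeedback (f τ) (w τ) (p τ) (a τ) hi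
      (neg_lt_neg_iff.1 hlt).le
    have h2 := hw' i
    unfold feedbackTerm at h1
    exact nonneg_of_mul_nonneg_right (by linarith : 0 ≤ net.inertia i * w' i) (net.inertia_pos i)
  · refine le_of_hasDerivAt_nonpos_above (hS 0 t) ht hc h0.2 fun τ hτ hτS hlt => ?_
    obtain ⟨-, w', hw, hw'⟩ := h.dynamicsAt (hint hτ) hτ.1 hτS
    refine ⟨_, hasDerivAt_pi.1 hw i, ?_⟩
    have h1 := net.directFeedback_le_feedbackTerm (f τ) (w τ) (p τ) (a τ) hi hlt.le
    have h2 := hw' i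
    unfold feedbackTerm at h1
    exact nonpos_of_mul_nonpos_right (by linarith : net.inertia i * w' i ≤ 0) (net.inertia_pos i)

theorem continuousOn_energy (h : net.IsClosedLoopTrajectory C p pf s Δ J f w a u) (fref : L → ℝ) :
    ContinuousOn (fun t => net.energy (f t - fref) (w t) (a t)) J := by
  have h1 := continuousOn_pi.1 h.continuous_flow
  have h2 := continuousOn_pi.1 h.continuous_freq
  have h3 := continuousOn_pi.1 h.continuous_filter
  unfold energy
  simp only [Pi.sub_apply]
  fun_prop

theorem filter_dissipation_nonneg (h : net.IsClosedLoopTrajectory C p pf s Δ J f w a u)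
    (hεT : ∀ i ∈ C.Iu, C.ε i * C.Tf i < 1) {t : ℝ} (ht : t ∈ J) (i : V) :
    0 ≤ (1 / C.Tf i - C.ε i) * a t i ^ 2 := by
  by_cases hi : i ∈ C.Iu
  · refine mul_nonneg (sub_nonneg.2 ?_) (sq_nonneg _)
    exact (le_div_iff₀ (C.Tf_pos i hi)).2 (hεT i hi).le
  · simp [h.filter_zero t ht i hi]

/-- There is no finite escape time: with a bounded injection the energy grows at most linearly. -/
theorem exists_bound (h : net.IsClosedLoopTrajectory C p pf s Δ J f w a u)
    (hεT : ∀ i ∈ C.Iu, C.ε i * C.Tf i < 1) (hp : PiecewiseContinuous p)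
    (hS : ∀ a b, (switchingTimes p Δ ∩ Icc a b).Finite) {τ : ℝ} (hJ : Ico 0 τ ⊆ J) :
    ∃ R : ℝ, ∀ t ∈ Ico 0 τ, ‖f t‖ ≤ R ∧ ‖w t‖ ≤ R ∧ ‖a t‖ ≤ R := by
  obtain ⟨P, hP⟩ := hp.exists_norm_le τ
  set K := ∑ i, P ^ 2 / (4 * net.damping i)
  have hK : 0 ≤ K := Finset.sum_nonneg fun i _ => by
    have := net.damping_pos i
    positivity
  obtain ⟨μ, hμ, hen⟩ := net.exists_norm_sq_le_energy
  set B := net.energy (f 0) (w 0) (a 0) + K * τ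
  have hle : ∀ t ∈ Ico 0 τ, net.energy (f t) (w t) (a t) ≤ B := by
    intro t ht
    have hJt : Icc 0 t ⊆ J := fun q hq => hJ ⟨hq.1, hq.2.trans_lt ht.2⟩
    have hint : Ioo 0 t ⊆ interior J := by
      rw [← interior_Icc]
      exact interior_mono hJt
    have h1 := sub_le_mul_of_hasDerivAt_off_finite (hS 0 t) ht.1
      ((h.continuousOn_energy 0).mono hJt) (C := K) fun q hq hqS => by
        obtain ⟨d, hd, hle⟩ := h.exists_hasDerivAt_energy (hint hq) hq.1 hqS 0
        refine ⟨d, hd, hle.trans (Finset.sum_le_sum fun i _ => ?_)⟩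
        have h2 := h.filter_dissipation_nonneg hεT (interior_subset (hint hq)) i
        have h3 : net.outflow 0 = 0 := map_zero net.outflowₗ
        rw [h3, Pi.zero_apply, sub_zero]
        have hE := net.damping_pos i
        have h4 : p q i ^ 2 ≤ P ^ 2 := by
          rw [← sq_abs]
          exact pow_le_pow_left₀ (abs_nonneg _)
            ((norm_le_pi_norm (p q) i).trans (hP q ⟨hq.1.le, (hq.2.trans ht.2).le⟩)) 2
        -- completing the square in `w i`
        have h5 : w q i * p q i - net.damping i * w q i ^ 2 ≤ p q i ^ 2 / (4 * net.damping i) := by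
          rw [le_div_iff₀ (by positivity)]
          nlinarith [sq_nonneg (p q i - 2 * net.damping i * w q i)]
        have h6 : p q i ^ 2 / (4 * net.damping i) ≤ P ^ 2 / (4 * net.damping i) :=
          div_le_div_of_nonneg_right h4 (by positivity)
        linarith
    simp only [sub_zero] at h1
    have := mul_le_mul_of_nonneg_left ht.2.le hK
    linarith
  refine ⟨√(B / μ), fun t ht => ?_⟩
  obtain ⟨h1, h2, h3⟩ := hen (f t) (w t) (a t)
  have h4 := hle t ht
  refine ⟨?_, ?_, ?_⟩ <;> refine Real.le_sqrt_of_sq_le ?_ <;> rw [le_div_iff₀ hμ] <;> linarith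

end IsClosedLoopTrajectory
end PowerNetwork

/-! ### Open-loop trajectories as closed-loop trajectories -/

/-- A design without controlled buses. -/
def ControlDesign.uncontrolled (V : Type*) : ControlDesign V where
  Iu := ∅
  Iw := ∅
  Iw_subset := Finset.Subset.refl _
  step := 1
  step_pos := one_pos
  horizon := 1
  horizon_pos := one_pos
  c _ := 1
  c_pos := by simp
  d := 1
  d_pos := one_pos
  ε _ := 1
  ε_pos := by simp
  Tf _ := 1
  Tf_pos := by simp
  wlo _ := 0
  whi _ := 0
  thrlo _ := 0
  thrhi _ := 0
  wlo_lt := by simp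
  thrlo_neg := by simp
  thrhi_pos := by simp
  lt_whi := by simp
  γlo _ := 1
  γhi _ := 1
  γlo_pos := by simp
  γhi_pos := by simp

namespace PowerNetwork

/-- The open-loop trajectories are the closed-loop trajectories without regions and controlled
buses. -/
theorem IsOpenLoopTrajectory.isClosedLoopTrajectory {V L : Type*} [Fintype V] [Fintype L]
    [DecidableEq V] {net : PowerNetwork V L} {p : ℝ → V → ℝ} {f : ℝ → L → ℝ} {w : ℝ → V → ℝ}
    (h : net.IsOpenLoopTrajectory p f w) :
    net.IsClosedLoopTrajectory (ControlDesign.uncontrolled V) p (fun _ _ => 0)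
      (Fin.elim0 : Fin 0 → Finset V) Fin.elim0 (Ici 0) f w (fun _ => 0) (fun _ => 0) where
  continuous_flow := h.continuous_flow
  continuous_freq := h.continuous_freq
  continuous_filter := continuousOn_const
  dynamics t ht hc _ := by
    rw [interior_Ici] at ht
    have h0 : ∀ t i,
        net.directFeedback (ControlDesign.uncontrolled V) (f t) (w t) (p t) 0 i = 0 := fun t i =>
      net.directFeedback_eq_zero _ _ _ _ fun hi => absurd hi (Finset.notMem_empty i)
    simpa [DynamicsAt, h0] using h.dynamics t ht hc
  filter _ _ _ _ i hi := absurd hi (Finset.notMem_empty i)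
  filter_zero _ _ _ _ := rfl
  mpc β := β.elim0

namespace IsClosedLoopTrajectory

variable {V L : Type*} [Fintype V] [Fintype L] [DecidableEq V] {net : PowerNetwork V L}
  {C : ControlDesign V} {p : ℝ → V → ℝ} {pf : ℝ → ℝ → V → ℝ} {r : ℕ} {s : Fin r → Finset V}
  {Δ : Fin r → ℕ → ℝ} {f : ℝ → L → ℝ} {w a u : ℝ → V → ℝ} {pstar : V → ℝ} {tbar : ℝ}
  {finf : L → ℝ}

/-! ### Convergence and stability -/

/-- Flows move only within the range of `Y_b D`: every linear functional that vanishes on this range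
is constant along the trajectory. -/
theorem sub_mem_range (h : net.IsClosedLoopTrajectory C p pf s Δ (Ici 0) f w a u)
    (hS : ∀ a b, (switchingTimes p Δ ∩ Icc a b).Finite) {t : ℝ} (ht : 0 ≤ t) :
    f t - f 0 ∈ LinearMap.range net.flowₗ := by
  by_contra hmem
  obtain ⟨φ, hφ, hker⟩ := Submodule.exists_dual_map_eq_bot_of_notMem hmem inferInstance
  have hz : ∀ θ, φ (net.flowₗ θ) = 0 := fun θ => by
    have : φ (net.flowₗ θ) ∈ (LinearMap.range net.flowₗ).map φ := ⟨_, ⟨θ, rfl⟩, rfl⟩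
    rwa [hker, Submodule.mem_bot] at this
  let ψ : (L → ℝ) →L[ℝ] ℝ := LinearMap.toContinuousLinearMap φ
  have h1 := abs_sub_le_mul_of_hasDerivAt_off_finite (g := fun t => ψ (f t)) (C := 0) (hS 0 t) ht
    (ψ.continuous.comp_continuousOn (h.continuous_flow.mono fun q hq => hq.1)) fun q hq hqS => by
      obtain ⟨hf, -⟩ := h.dynamicsAt (by rw [interior_Ici]; exact hq.1) hq.1 hqS
      refine ⟨_, ψ.hasFDerivAt.comp_hasDerivAt q hf, ?_⟩
      have : ψ (fun e => net.susceptance e * net.diff (w q) e) = 0 := hz (w q)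
      rw [this, abs_zero]
  rw [zero_mul] at h1
  refine hφ ?_
  rw [map_sub]
  exact abs_nonpos_iff.1 h1

/-- Once the injection is constant, the energy relative to the equilibrium is dissipated. -/
theorem exists_hasDerivAt_energy_le_neg
    (h : net.IsClosedLoopTrajectory C p pf s Δ (Ici 0) f w a u) (htbar : 0 ≤ tbar)
    (hpstar : ∀ t, tbar ≤ t → p t = pstar) (hfinf : net.outflow finf = pstar) {t : ℝ}
    (ht : tbar < t) (htS : t ∉ switchingTimes p Δ) :
    ∃ d, HasDerivAt (fun s => net.energy (f s - finf) (w s) (a s)) d t ∧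
      d ≤ -∑ i, (net.damping i * w t i ^ 2 + (1 / C.Tf i - C.ε i) * a t i ^ 2) := by
  have ht0 := htbar.trans_lt ht
  obtain ⟨d, hd, hle⟩ := h.exists_hasDerivAt_energy (by rwa [interior_Ici]) ht0 htS finf
  refine ⟨d, hd, hle.trans_eq ?_⟩
  rw [← Finset.sum_neg_distrib]
  refine Finset.sum_congr rfl fun i _ => ?_
  rw [hpstar t ht.le, hfinf]
  ring

theorem dissipation_term_nonneg (h : net.IsClosedLoopTrajectory C p pf s Δ (Ici 0) f w a u)
    (hεT : ∀ i ∈ C.Iu, C.ε i * C.Tf i < 1) {t : ℝ} (ht : 0 ≤ t) (i : V) :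
    0 ≤ net.damping i * w t i ^ 2 + (1 / C.Tf i - C.ε i) * a t i ^ 2 :=
  add_nonneg (mul_nonneg (net.damping_pos i).le (sq_nonneg _))
    (h.filter_dissipation_nonneg hεT ht i)

theorem energy_le (h : net.IsClosedLoopTrajectory C p pf s Δ (Ici 0) f w a u)
    (hεT : ∀ i ∈ C.Iu, C.ε i * C.Tf i < 1)
    (hS : ∀ a b, (switchingTimes p Δ ∩ Icc a b).Finite) (htbar : 0 ≤ tbar)
    (hpstar : ∀ t, tbar ≤ t → p t = pstar) (hfinf : net.outflow finf = pstar) {t1 t : ℝ}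
    (ht1 : tbar ≤ t1) (ht : t1 ≤ t) :
    net.energy (f t - finf) (w t) (a t) ≤ net.energy (f t1 - finf) (w t1) (a t1) := by
  have h1 := sub_le_mul_of_hasDerivAt_off_finite (hS t1 t) ht
    ((h.continuousOn_energy finf).mono fun q hq => (htbar.trans ht1).trans hq.1) (C := 0)
    fun q hq hqS => by
      obtain ⟨d, hd, hle⟩ := h.exists_hasDerivAt_energy_le_neg htbar hpstar hfinf
        (ht1.trans_lt hq.1) hqS
      exact ⟨d, hd, hle.trans (neg_nonpos.2 (Finset.sum_nonneg fun i _ =>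
        h.dissipation_term_nonneg hεT ((htbar.trans ht1).trans hq.1.le) i))⟩
  linarith

theorem exists_bound_of_const (h : net.IsClosedLoopTrajectory C p pf s Δ (Ici 0) f w a u)
    (hεT : ∀ i ∈ C.Iu, C.ε i * C.Tf i < 1)
    (hS : ∀ a b, (switchingTimes p Δ ∩ Icc a b).Finite) (htbar : 0 ≤ tbar)
    (hpstar : ∀ t, tbar ≤ t → p t = pstar) (hfinf : net.outflow finf = pstar) :
    ∃ R : ℝ, ∀ t, tbar ≤ t → ‖f t - finf‖ ≤ R ∧ ‖w t‖ ≤ R ∧ ‖a t‖ ≤ R := by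
  obtain ⟨μ, hμ, hen⟩ := net.exists_norm_sq_le_energy
  refine ⟨√(net.energy (f tbar - finf) (w tbar) (a tbar) / μ), fun t ht => ?_⟩
  obtain ⟨h1, h2, h3⟩ := hen (f t - finf) (w t) (a t)
  have h4 := h.energy_le hεT hS htbar hpstar hfinf le_rfl ht
  refine ⟨?_, ?_, ?_⟩ <;> refine Real.le_sqrt_of_sq_le ?_ <;> rw [le_div_iff₀ hμ] <;> linarith

theorem tendsto_freq (h : net.IsClosedLoopTrajectory C p pf s Δ (Ici 0) f w a u)
    (hεT : ∀ i ∈ C.Iu, C.ε i * C.Tf i < 1)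
    (hS : ∀ a b, (switchingTimes p Δ ∩ Icc a b).Finite) (htbar : 0 ≤ tbar)
    (hpstar : ∀ t, tbar ≤ t → p t = pstar) (hfinf : net.outflow finf = pstar) :
    Tendsto w atTop (𝓝 0) := by
  obtain ⟨R, hR⟩ := h.exists_bound_of_const hεT hS htbar hpstar hfinf
  let O : (L → ℝ) →L[ℝ] (V → ℝ) := LinearMap.toContinuousLinearMap net.outflowₗ
  refine tendsto_pi_nhds.2 fun i => ?_
  have hE := net.damping_pos i
  have hM := net.inertia_pos i
  refine tendsto_zero_of_dissipation (t0 := tbar) (c := net.damping i)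
    (K := (|C.γhi i| + |C.γlo i| + 2 * (net.damping i * R + ‖O‖ * R + R)) / net.inertia i)
    (U := fun t => net.energy (f t - finf) (w t) (a t))
    hS hE (fun t _ => net.energy_nonneg _ _ _)
    ((h.continuousOn_energy finf).mono (Ici_subset_Ici.2 htbar)) (fun t ht htS => ?_)
    ((continuousOn_pi.1 h.continuous_freq i).mono (Ici_subset_Ici.2 htbar)) fun t ht htS => ?_
  · obtain ⟨d, hd, hle⟩ := h.exists_hasDerivAt_energy_le_neg htbar hpstar hfinf ht htS
    refine ⟨d, hd, hle.trans (neg_le_neg ?_)⟩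
    exact (le_add_of_nonneg_right (h.filter_dissipation_nonneg hεT (htbar.trans ht.le) i)).trans
      (Finset.single_le_sum (fun i _ => h.dissipation_term_nonneg hεT (htbar.trans ht.le) i)
        (Finset.mem_univ i))
  · have ht0 := htbar.trans_lt ht
    obtain ⟨-, w', hw, hw'⟩ := h.dynamicsAt (by rwa [interior_Ici]) ht0 htS
    refine ⟨_, hasDerivAt_pi.1 hw i, ?_⟩
    obtain ⟨r1, r2, r3⟩ := hR t ht.le
    have b1 : |net.outflow (f t - finf) i| ≤ ‖O‖ * R :=
      ((norm_le_pi_norm _ i).trans (O.le_opNorm _)).trans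
        (mul_le_mul_of_nonneg_left r1 (norm_nonneg _))
    have b2 : |net.damping i * w t i| ≤ net.damping i * R := by
      rw [abs_mul, abs_of_pos hE]
      exact mul_le_mul_of_nonneg_left ((norm_le_pi_norm (w t) i).trans r2) hE.le
    have b3 : |a t i| ≤ R := (norm_le_pi_norm (a t) i).trans r3
    have hv : net.feedbackTerm (f t) (w t) (p t) (a t) i =
        net.damping i * w t i + net.outflow (f t - finf) i - a t i := by
      rw [feedbackTerm, outflow_sub, hfinf, hpstar t ht.le, Pi.sub_apply]
      ring
    have b4 : |net.feedbackTerm (f t) (w t) (p t) (a t) i| ≤ net.damping i * R + ‖O‖ * R + R := by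
      rw [hv]
      rw [abs_le] at b1 b2 b3 ⊢
      constructor <;> linarith [b1.1, b1.2, b2.1, b2.2, b3.1, b3.2]
    have b5 := net.abs_directFeedback_le (C := C) (f t) (w t) (p t) (a t) (i := i)
    have e := hw' i
    have e' : net.inertia i * w' i = net.directFeedback C (f t) (w t) (p t) (a t) i -
        net.feedbackTerm (f t) (w t) (p t) (a t) i := by
      rw [e, feedbackTerm]
      ring
    have b6 : |net.inertia i * w' i| ≤
        |C.γhi i| + |C.γlo i| + 2 * (net.damping i * R + ‖O‖ * R + R) := by
      rw [e']
      exact (abs_sub _ _).trans (by linarith)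
    rw [abs_mul, abs_of_pos hM] at b6
    rwa [le_div_iff₀ hM, mul_comm]

theorem tendsto_filter (h : net.IsClosedLoopTrajectory C p pf s Δ (Ici 0) f w a u)
    (hεT : ∀ i ∈ C.Iu, C.ε i * C.Tf i < 1)
    (hS : ∀ a b, (switchingTimes p Δ ∩ Icc a b).Finite) (htbar : 0 ≤ tbar)
    (hpstar : ∀ t, tbar ≤ t → p t = pstar) (hfinf : net.outflow finf = pstar) :
    Tendsto a atTop (𝓝 0) := by
  obtain ⟨R, hR⟩ := h.exists_bound_of_const hεT hS htbar hpstar hfinf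
  refine tendsto_pi_nhds.2 fun i => ?_
  by_cases hi : i ∈ C.Iu
  swap
  · refine tendsto_const_nhds.congr' ?_
    filter_upwards [eventually_ge_atTop 0] with t ht using (h.filter_zero t ht i hi).symm
  have hT := C.Tf_pos i hi
  have hε := C.ε_pos i hi
  refine tendsto_zero_of_dissipation (t0 := tbar) (c := 1 / C.Tf i - C.ε i)
    (K := R / C.Tf i + R + C.ε i * R)
    (U := fun t => net.energy (f t - finf) (w t) (a t))
    hS (sub_pos.2 ((lt_div_iff₀ hT).2 (hεT i hi))) (fun t _ => net.energy_nonneg _ _ _)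
    ((h.continuousOn_energy finf).mono (Ici_subset_Ici.2 htbar)) (fun t ht htS => ?_)
    ((continuousOn_pi.1 h.continuous_filter i).mono (Ici_subset_Ici.2 htbar)) fun t ht htS => ?_
  · obtain ⟨d, hd, hle⟩ := h.exists_hasDerivAt_energy_le_neg htbar hpstar hfinf ht htS
    refine ⟨d, hd, hle.trans (neg_le_neg ?_)⟩
    exact (le_add_of_nonneg_left (mul_nonneg (net.damping_pos i).le (sq_nonneg _))).trans
      (Finset.single_le_sum (fun i _ => h.dissipation_term_nonneg hεT (htbar.trans ht.le) i)
        (Finset.mem_univ i))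
  · have ht0 := htbar.trans_lt ht
    obtain ⟨a', ha, ha', -⟩ := h.exists_hasDerivAt_filter (by rwa [interior_Ici]) ht0 htS
    refine ⟨_, hasDerivAt_pi.1 ha i, ?_⟩
    obtain ⟨-, r2, r3⟩ := hR t ht.le
    have b2 : |w t i| ≤ R := (norm_le_pi_norm (w t) i).trans r2
    have b3 : |a t i| ≤ R := (norm_le_pi_norm (a t) i).trans r3
    have b4 : |a t i / C.Tf i| ≤ R / C.Tf i := by
      rw [abs_div, abs_of_pos hT]
      exact div_le_div_of_nonneg_right b3 hT.le
    have b5 : |C.stabilityFilter (a t) (u t) i| ≤ C.ε i * R :=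
      (abs_sat_le (mul_nonneg hε.le (abs_nonneg _))).trans (mul_le_mul_of_nonneg_left b3 hε.le)
    rw [ha' i hi]
    rw [abs_le] at b2 b4 b5 ⊢
    constructor <;> linarith [b2.1, b2.2, b4.1, b4.2, b5.1, b5.2]

/-- Since the frequencies settle, the power imbalance at each bus, which drives them, vanishes in
the limit, and it determines the deviation of the flow from the equilibrium. -/
theorem tendsto_flow (h : net.IsClosedLoopTrajectory C p pf s Δ (Ici 0) f w a u)
    (hεT : ∀ i ∈ C.Iu, C.ε i * C.Tf i < 1)
    (hS : ∀ a b, (switchingTimes p Δ ∩ Icc a b).Finite) (htbar : 0 ≤ tbar)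
    (hpstar : ∀ t, tbar ≤ t → p t = pstar) (hfinf : net.IsEquilibriumFlow pstar (f 0) finf) :
    Tendsto f atTop (𝓝 finf) := by
  obtain ⟨hout, hrange⟩ := net.isEquilibriumFlow_iff.1 hfinf
  have hw := h.tendsto_freq hεT hS htbar hpstar hout
  have ha := h.tendsto_filter hεT hS htbar hpstar hout
  have hdf : Tendsto (fun t => net.directFeedback C (f t) (w t) (p t) (a t)) atTop (𝓝 0) :=
    net.tendsto_directFeedback hw
  let O : (L → ℝ) →L[ℝ] (V → ℝ) := LinearMap.toContinuousLinearMap net.outflowₗ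
  let Λ : (V → ℝ) →L[ℝ] (V → ℝ) := O.comp (LinearMap.toContinuousLinearMap net.flowₗ)
  have hx : Tendsto (fun t => f t - finf) atTop (𝓝 0) := by
    refine net.tendsto_zero_of_outflow ?_ (tendsto_pi_nhds.2 fun i => ?_)
    · filter_upwards [eventually_ge_atTop 0] with t ht
      have := Submodule.sub_mem _ (h.sub_mem_range hS ht) hrange
      rwa [sub_sub_sub_cancel_right] at this
    have hwi := tendsto_pi_nhds.1 hw i
    have hq' : Tendsto (fun t => Λ (w t) i) atTop (𝓝 0) := by
      have h1 := tendsto_pi_nhds.1 ((Λ.continuous.tendsto 0).comp hw) i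
      rwa [map_zero] at h1
    have hρ : Tendsto (fun t => -(net.damping i * w t i) +
        (net.directFeedback C (f t) (w t) (p t) (a t) i + a t i)) atTop (𝓝 0) := by
      have := ((hwi.const_mul (net.damping i)).neg).add
        ((tendsto_pi_nhds.1 hdf i).add (tendsto_pi_nhds.1 ha i))
      simpa using this
    have hxc : ContinuousOn (fun t => O (f t - finf)) (Ici 0) :=
      O.continuous.comp_continuousOn (h.continuous_flow.sub continuousOn_const)
    refine tendsto_zero_of_slowly_varying (z := fun t => net.inertia i * w t i) (t0 := tbar) hS
      (by simpa using hwi.const_mul (net.inertia i)) hρ hq'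
      ((continuousOn_const.mul (continuousOn_pi.1 h.continuous_freq i)).mono
        (Ici_subset_Ici.2 htbar))
      ((continuousOn_pi.1 hxc i).mono (Ici_subset_Ici.2 htbar))
      (fun t ht htS => ?_) fun t ht htS => ?_
    all_goals
      have ht0 := htbar.trans_lt ht
      obtain ⟨hf, w', hw1, hw2⟩ := h.dynamicsAt (by rwa [interior_Ici]) ht0 htS
    · have h1 := (hasDerivAt_pi.1 hw1 i).const_mul (net.inertia i)
      refine h1.congr_deriv ?_
      rw [hw2 i, outflow_sub, hout, ← hpstar t ht.le, Pi.sub_apply]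
      ring
    · exact hasDerivAt_pi.1 (O.hasFDerivAt.comp_hasDerivAt t (hf.sub_const finf)) i
  simpa using hx.add_const finf

end IsClosedLoopTrajectory

/-- Lyapunov stability: the energy is positive definite and does not increase. The bound `δ` depends
only on the network and on `η`. -/
theorem exists_stability_bound {V L : Type*} [Fintype V] [Fintype L] [DecidableEq V]
    (net : PowerNetwork V L) {η : ℝ} (hη : 0 < η) : ∃ δ : ℝ, 0 < δ ∧
      ∀ (x y : L → ℝ) (w a w' a' : V → ℝ), net.energy y w' a' ≤ net.energy x w a →
        ‖x‖ < δ → ‖w‖ < δ → ‖a‖ < δ → ‖y‖ < η ∧ ‖w'‖ < η ∧ ‖a'‖ < η := by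
  obtain ⟨μ, hμ, hen⟩ := net.exists_norm_sq_le_energy
  obtain ⟨ν, hν, hle⟩ := net.exists_energy_le_mul_sq
  refine ⟨√(μ * η ^ 2 / (2 * ν)), Real.sqrt_pos.2 (by positivity),
    fun x y w a w' a' h hx hw ha => ?_⟩
  have h1 := hle x w a _ hx.le hw.le ha.le
  have hlt : net.energy y w' a' < μ * η ^ 2 := by
    refine (h.trans h1).trans_lt ?_
    rw [Real.sq_sqrt (by positivity)]
    have e : ν * (μ * η ^ 2 / (2 * ν)) = μ * η ^ 2 / 2 := by field_simp
    rw [e]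
    have : 0 < μ * η ^ 2 := by positivity
    linarith
  have key : ∀ n : ℝ, μ * n ^ 2 ≤ net.energy y w' a' → n < η := fun n hn =>
    lt_of_pow_lt_pow_left₀ 2 hη.le (lt_of_mul_lt_mul_left (hn.trans_lt hlt) hμ.le)
  obtain ⟨h2, h3, h4⟩ := hen y w' a'
  exact ⟨key _ h2, key _ h3, key _ h4⟩

end PowerNetwork

end

/-! ### Assembling the conclusions -/

theorem mainTheorem2 {V L : Type*} [Fintype V] [DecidableEq V] [Fintype L]
    (net : PowerNetwork V L) (hconn : net.graph.Connected)
    (C : ControlDesign V) (hεT : ∀ i ∈ C.Iu, C.ε i * C.Tf i < 1)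
    (p : ℝ → V → ℝ) (hp : PiecewiseContinuous p)
    (pstar : V → ℝ) (tbar : ℝ) (htbar : 0 ≤ tbar) (hpstar : ∀ t, tbar ≤ t → p t = pstar)
    (hbal : ∑ i, pstar i = 0)
    (pf : ℝ → ℝ → V → ℝ)
    {r : ℕ} (s : Fin r → Finset V)
    (hcover : ∀ i ∈ C.Iu, ∃ β, i ∈ s β)
    (hdisj : ∀ β η, β ≠ η → s β ∩ s η ∩ C.Iu = ∅)
    (Δ : Fin r → ℕ → ℝ) (hΔ0 : ∀ β, Δ β 0 = 0) (hΔmono : ∀ β, StrictMono (Δ β))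
    (hΔtop : ∀ β, Tendsto (Δ β) atTop atTop) :
    -- trajectories stay bounded in finite time and satisfy frequency invariance
    (∀ τ : ℝ, 0 < τ → ∀ (f : ℝ → L → ℝ) (w a u : ℝ → V → ℝ),
      net.IsClosedLoopTrajectory C p pf s Δ (Ico 0 τ) f w a u →
      (∃ R : ℝ, ∀ t ∈ Ico 0 τ, ‖f t‖ ≤ R ∧ ‖w t‖ ≤ R ∧ ‖a t‖ ≤ R) ∧
      (∀ i ∈ C.Iw, w 0 i ∈ Icc (C.wlo i) (C.whi i) →
        ∀ t ∈ Ico 0 τ, w t i ∈ Icc (C.wlo i) (C.whi i))) ∧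
    -- the equilibrium, and convergence to it of the open-loop system
    (∀ f0 : L → ℝ, ∃! finf : L → ℝ, net.IsEquilibriumFlow pstar f0 finf) ∧
    (∀ (f : ℝ → L → ℝ) (w : ℝ → V → ℝ), net.IsOpenLoopTrajectory p f w →
      ∀ finf, net.IsEquilibriumFlow pstar (f 0) finf →
        Tendsto f atTop (𝓝 finf) ∧ Tendsto w atTop (𝓝 0)) ∧
    (∀ (f : ℝ → L → ℝ) (w a u : ℝ → V → ℝ),
      net.IsClosedLoopTrajectory C p pf s Δ (Ici 0) f w a u →
      -- (i) frequency invariance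
      (∀ i ∈ C.Iw, w 0 i ∈ Icc (C.wlo i) (C.whi i) →
        ∀ t, 0 ≤ t → w t i ∈ Icc (C.wlo i) (C.whi i)) ∧
      -- (ii) frequency attractivity
      (∀ i ∈ C.Iw, w 0 i ∉ Icc (C.wlo i) (C.whi i) →
        ∃ t0, 0 ≤ t0 ∧ ∀ t, t0 ≤ t → w t i ∈ Icc (C.wlo i) (C.whi i)) ∧
      -- (iii) convergence to the equilibrium of the open-loop system
      (∀ finf, net.IsEquilibriumFlow pstar (f 0) finf →
        Tendsto f atTop (𝓝 finf) ∧ Tendsto w atTop (𝓝 0)) ∧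
      -- the control signals vanish asymptotically
      Tendsto a atTop (𝓝 0) ∧
      Tendsto (fun t => net.directFeedback C (f t) (w t) (p t) (a t)) atTop (𝓝 0) ∧
      Tendsto (fun t => net.directFeedback C (f t) (w t) (p t) (a t) + a t) atTop (𝓝 0)) ∧
    -- (iii) Lyapunov stability of the equilibrium once the injection is constant
    (∀ η : ℝ, 0 < η → ∃ δ : ℝ, 0 < δ ∧ ∀ (f : ℝ → L → ℝ) (w a u : ℝ → V → ℝ),
      net.IsClosedLoopTrajectory C p pf s Δ (Ici 0) f w a u →
      ∀ finf, net.IsEquilibriumFlow pstar (f 0) finf →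
      ∀ t1, tbar ≤ t1 → ‖f t1 - finf‖ < δ → ‖w t1‖ < δ → ‖a t1‖ < δ →
        ∀ t, t1 ≤ t → ‖f t - finf‖ < η ∧ ‖w t‖ < η ∧ ‖a t‖ < η) := by
  have hS := switchingTimes_inter_Icc_finite (p := p) hp hΔtop
  refine ⟨fun τ _ f w a u h => ⟨h.exists_bound hεT hp hS Subset.rfl, fun i hi h0 t ht =>
      h.freq_mem_Icc hS ht.1 (fun q hq => ⟨hq.1, hq.2.trans_lt ht.2⟩) hi h0⟩,
    net.existsUnique_isEquilibriumFlow hconn hbal, fun f w h finf hfinf => ?_,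
    fun f w a u h => ?_, fun η hη => ?_⟩
  · have hcl := h.isClosedLoopTrajectory
    have hS' := switchingTimes_inter_Icc_finite (p := p) (Δ := (Fin.elim0 : Fin 0 → ℕ → ℝ)) hp
      fun β => β.elim0
    have hε : ∀ i ∈ (ControlDesign.uncontrolled V).Iu, (ControlDesign.uncontrolled V).ε i *
      (ControlDesign.uncontrolled V).Tf i < 1 := fun i hi => absurd hi (Finset.notMem_empty i)
    exact ⟨hcl.tendsto_flow hε hS' htbar hpstar hfinf,
      hcl.tendsto_freq hε hS' htbar hpstar hfinf.1⟩
  · obtain ⟨f₁, hf₁, -⟩ := net.existsUnique_isEquilibriumFlow hconn hbal (f 0)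
    have hw := h.tendsto_freq hεT hS htbar hpstar hf₁.1
    have ha := h.tendsto_filter hεT hS htbar hpstar hf₁.1
    have hdf : Tendsto (fun t => net.directFeedback C (f t) (w t) (p t) (a t)) atTop (𝓝 0) :=
      net.tendsto_directFeedback hw
    refine ⟨fun i hi h0 t ht => h.freq_mem_Icc hS ht (fun q hq => hq.1) hi h0, fun i hi _ => ?_,
      fun finf hfinf => ⟨h.tendsto_flow hεT hS htbar hpstar hfinf, hw⟩, ha, hdf,
      by simpa using hdf.add ha⟩
    -- the safe interval is a neighbourhood of the limit frequency
    have hmem : Icc (C.wlo i) (C.whi i) ∈ 𝓝 ((0 : V → ℝ) i) :=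
      Icc_mem_nhds ((C.wlo_lt i hi).trans (C.thrlo_neg i hi))
        ((C.thrhi_pos i hi).trans (C.lt_whi i hi))
    obtain ⟨t0, ht0⟩ := eventually_atTop.1 ((tendsto_pi_nhds.1 hw i).eventually hmem)
    exact ⟨max t0 0, le_max_right _ _, fun t ht => ht0 t ((le_max_left _ _).trans ht)⟩
  · obtain ⟨δ, hδ, hstab⟩ := net.exists_stability_bound hη
    exact ⟨δ, hδ, fun f w a u h finf hfinf t1 ht1 hf hw ha t ht =>
      hstab _ _ _ _ _ _ (h.energy_le hεT hS htbar hpstar hfinf.1 ht1 ht) hf hw ha⟩
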